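/- Let $(\mathcal B_i\subseteq\mathcal A_i)_{i\in I}$ be a (finite or infinite) family of unital inclusions of unital $C^*$-algebras. Let $\mathcal A=\bigotimes_{i\in I}\mathcal A_i$ be the minimal $C^*$-tensor product and let $\mathcal B=\bigotimes_{i\in I}\mathcal B_i\subseteq\mathcal A$, identified with the closed linear span of the elementary tensors $\otimes_i b_i$ with $b_i\in\mathcal B_i$ and $b_i=1$ for all but finitely many $i$. For states $\varphi_i$ on $\mathcal A_i$, let $\otimes_i\varphi_i$ be the product state on $\mathcal A$, i.e. the state determined by $(\otimes_i\varphi_i)(\otimes_i a_i)=\prod_i\varphi_i(a_i)$ for elementary tensors ($a_i=1$ for all but finitely many $i$). For a unital inclusion $\mathcal D\subseteq\mathcal C$ of $C^*$-algebras: - it has the relative Dixmier property if $C_{\mathcal D}(c)\cap\mathbb C1\neq\emptyset$ for every $c\in\mathcal C$, where $C_{\mathcal D}(c)$ is the norm closure of the convex hull of $\{u^*cu: u\in\mathcal U(\mathcal D)\}$; - it has the relative excision property with respect to a state $\psi$ on $\mathcal C$ if there is a net $(h_\alpha)$ of positive elements of $\mathcal D$ with $\|h_\alpha\|=1$ and $\lim_\alpha\|h_\alpha^{1/2}ch_\alpha^{1/2}-\psi(c)h_\alpha\|=0$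 for all $c\in\mathcal C$; - it is $C^*$-irreducible if every $C^*$-algebra $\mathcal E$ with $\mathcal D\subseteq\mathcal E\subseteq\mathcal C$ (including $\mathcal D$ and $\mathcal C$) is simple, i.e. non-zero with no non-trivial closed two-sided ideals. Then: (i) If, for each $i\in I$, $\tau_i$ is a faithful tracial state on $\mathcal A_i$ and $\mathcal B_i\subseteq\mathcal A_i$ has the relative Dixmier property, then $\tau=\otimes_i\tau_i$ is a faithful tracial state on $\mathcal A$, the inclusion $\mathcal B\subseteq\mathcal A$ has the relative Dixmier property, with $C_{\mathcal B}(a)\cap\mathbb C1=\{\tau(a)1\}$ for all $a\in\mathcal A$, and $\mathcal B\subseteq\mathcal A$ is $C^*$-irreducible. (ii) If, for each $i\in I$, $\psi_i$ is a faithful state on $\mathcal A_i$ and $\mathcal B_i\subseteq\mathcal A_i$ has the relative excision property with respect to $\psi_i$, then $\psi=\otimes_i\psi_i$ is a faithful state on $\mathcal A$ and $\mathcal B\subseteq\mathcal A$ has the relative excision property with respect to $\psi$. If, in addition, each $\mathcal B_i$ is simple, then $\mathcal B\subseteq\mathcal A$ is $C^*$-irreducible. -/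

import Mathlib

noncomputable section

open scoped ComplexOrder ENNReal

section Psd

theorem Matrix.PosSemidef.of_finset {X : Type*} {M : Matrix X X ℂ}
    (h : ∀ t : Finset X, (M.submatrix (Subtype.val : t → X) Subtype.val).PosSemidef) :
    M.PosSemidef := by
  classical
  refine ⟨?_, fun x => ?_⟩
  · ext i j
    have := congrFun (congrFun (h {i, j}).1 ⟨i, by simp⟩) ⟨j, by simp⟩
    simpa [Matrix.conjTranspose_apply] using this
  · have := (h x.support).2 (x.comapDomain Subtype.val Subtype.val_injective.injOn)
    simp only [Finsupp.sum, Finsupp.comapDomain_apply, Finsupp.comapDomain_support,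
      Matrix.submatrix_apply] at this
    convert this using 1
    simp only [Finsupp.sum]
    rw [← Finset.sum_attach]
    have e : x.support.preimage (Subtype.val : x.support → X) Subtype.val_injective.injOn
        = Finset.univ := by ext; simp
    rw [Finset.univ_eq_attach] at e
    rw [e]
    refine Finset.sum_congr rfl fun i _ => ?_
    rw [← Finset.sum_attach]

theorem Matrix.PosSemidef.hadamard' {X : Type*} {M N : Matrix X X ℂ}
    (hM : M.PosSemidef) (hN : N.PosSemidef) :
    (Matrix.of fun a b => M a b * N a b).PosSemidef :=
  .of_finset fun _ => ((hM.submatrix _).kronecker (hN.submatrix _)).submatrix fun a => (a, a)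

theorem Matrix.PosSemidef.prod' {X I : Type*} (K : I → Matrix X X ℂ)
    (hK : ∀ i, (K i).PosSemidef) (F : Finset I) :
    (Matrix.of fun a b => ∏ i ∈ F, K i a b).PosSemidef := by
  classical
  induction F using Finset.induction_on with
  | empty =>
    have := Matrix.posSemidef_vecMulVec_self_star (fun _ : Unit => (1:ℂ))
    convert this.submatrix (fun _ : X => ()) using 1
    ext; simp [Matrix.vecMulVec]
  | insert i F hi ih =>
    simp only [Finset.prod_insert hi]
    exact (hK i).hadamard' ih

theorem Matrix.PosSemidef.prod_sub {X I : Type*} (K L : I → Matrix X X ℂ)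
    (hK : ∀ i, (K i).PosSemidef) (hL : ∀ i, (L i).PosSemidef)
    (h : ∀ i, (K i - L i).PosSemidef) (F : Finset I) :
    (Matrix.of fun a b => ∏ i ∈ F, K i a b - ∏ i ∈ F, L i a b).PosSemidef := by
  classical
  induction F using Finset.induction_on with
  | empty =>
    convert Matrix.PosSemidef.zero using 1
    ext; simp
  | insert i F hi ih =>
    convert ((h i).hadamard' (Matrix.PosSemidef.prod' K hK F)).add ((hL i).hadamard' ih) using 1
    ext a b
    simp [Finset.prod_insert hi]
    ring
end Psd

/-- A state on a unital C*-algebra: a linear functional `φ` with `φ (a* a) ≥ 0` for all `a`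
and `φ 1 = 1`. -/
structure CStarState (A : Type*) [CStarAlgebra A] extends A →ₗ[ℂ] ℂ where
  nonneg' : ∀ a : A, 0 ≤ toLinearMap (star a * a)
  map_one' : toLinearMap 1 = 1

namespace CStarState

variable {A : Type*} [CStarAlgebra A]

instance : CoeFun (CStarState A) (fun _ => A → ℂ) := ⟨fun φ => φ.toLinearMap⟩

theorem nonneg (φ : CStarState A) (a : A) : 0 ≤ φ (star a * a) := φ.nonneg' a

@[simp] theorem map_one (φ : CStarState A) : φ 1 = 1 := φ.map_one'

/-- Faithfulness: `φ (a* a) = 0` only for `a = 0`. -/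
def IsFaithful (φ : CStarState A) : Prop := ∀ a : A, φ (star a * a) = 0 → a = 0

/-- The trace property. -/
def IsTracial (φ : CStarState A) : Prop := ∀ a b : A, φ (a * b) = φ (b * a)

theorem sum_sum_mul (φ : CStarState A) {X : Type*} (v : X → A) (x y : X →₀ ℂ) :
    (x.sum fun a xa => y.sum fun b yb => star xa * φ (star (v a) * v b) * yb)
      = φ (star (x.sum fun a xa => xa • v a) * y.sum fun b yb => yb • v b) := by
  simp only [Finsupp.sum, star_sum, star_smul, Finset.sum_mul, Finset.mul_sum, map_sum,
    smul_mul_assoc, mul_smul_comm, map_smul, smul_eq_mul]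
  rw [Finset.sum_comm]
  refine Finset.sum_congr rfl fun a _ => Finset.sum_congr rfl fun b _ => by ring

theorem posSemidef_gram (φ : CStarState A) {X : Type*} (v : X → A) :
    (Matrix.of fun a b => φ (star (v a) * v b)).PosSemidef := by
  have key : ∀ x : X →₀ ℂ,
      0 ≤ x.sum fun a xa => x.sum fun b yb => star xa * φ (star (v a) * v b) * yb := fun x => by
    rw [sum_sum_mul]; exact φ.nonneg _
  refine ⟨?_, key⟩
  have hreal : ∀ c : A, (φ (star c * c)).im = 0 := fun c => (Complex.nonneg_iff.1 (φ.nonneg c)).2.symm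
  ext a b
  simp only [Matrix.conjTranspose_apply, Matrix.of_apply]
  have h1 := hreal (v a + v b)
  have h2 := hreal (v a + Complex.I • v b)
  have ha := hreal (v a)
  have hb := hreal (v b)
  simp only [star_add, star_smul, add_mul, mul_add, smul_mul_assoc, mul_smul_comm, map_add,
    map_smul, smul_eq_mul, Complex.add_im, ha, hb] at h1 h2
  simp [Complex.mul_im, hb] at h1 h2
  apply Complex.ext <;> simp <;> linarith

theorem posSemidef_gram_sub (φ : CStarState A) {X : Type*} (v : X → A) (c : A) :
    (((‖c‖ ^ 2 : ℝ) : ℂ) • (Matrix.of fun a b => φ (star (v a) * v b)) -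
      Matrix.of fun a b => φ (star (c * v a) * (c * v b))).PosSemidef := by
  let _ := CStarAlgebra.spectralOrder A
  have _ := CStarAlgebra.spectralOrderedRing A
  have h0 : (0 : A) ≤ algebraMap ℝ A (‖c‖ ^ 2) - star c * c := by
    rw [sub_nonneg]
    have := CStarAlgebra.star_mul_le_algebraMap_norm_sq (a := c)
    exact this
  obtain ⟨d, hd⟩ := CStarAlgebra.nonneg_iff_eq_star_mul_self.1 h0
  convert φ.posSemidef_gram (fun a => d * v a) using 1
  ext a b
  have : star (d * v a) * (d * v b)
      = ((‖c‖ ^ 2 : ℝ) : ℂ) • (star (v a) * v b) - star (c * v a) * (c * v b) := by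
    have e : star (d * v a) * (d * v b) = star (v a) * (star d * d) * v b := by
      simp [mul_assoc]
    rw [e, ← hd, Algebra.algebraMap_eq_smul_one, mul_sub, sub_mul]
    rw [mul_smul_comm, smul_mul_assoc, mul_one, Complex.coe_smul]
    simp [mul_assoc]
  simp only [Matrix.of_apply, this, map_sub, map_smul, Matrix.sub_apply, Matrix.smul_apply]

end CStarState

/-- The bounded families in a family of unital C*-algebras form a C*-algebra. -/
def lpInftyCStarAlgebra {ι : Type*} (E : ι → Type*) [∀ i, CStarAlgebra (E i)]
    [∀ i, Nontrivial (E i)] : CStarAlgebra (lp E ∞) where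

section MinTensor

universe u v

variable {I : Type u} (A : I → Type v) [∀ i, CStarAlgebra (A i)]

/-- The index set of elementary tensors `⊗ aᵢ`: families with `aᵢ = 1` for all but finitely
many `i`, with coordinatewise multiplication. -/
def ElemTensor : Submonoid (∀ i, A i) where
  carrier := {a | {i | a i ≠ 1}.Finite}
  one_mem' := by simp
  mul_mem' {a b} ha hb := by
    refine (Set.Finite.union ha hb).subset fun i hi => ?_
    by_contra h
    simp only [Set.mem_union, Set.mem_ofPred_eq, not_or, not_not] at h
    exact hi (by simp [h.1, h.2])

variable {A}

/-- The kernel `(a, b) ↦ ∏ᵢ sᵢ (aᵢ* bᵢ)` of a family of states `(sᵢ)`. -/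
def prodKernel (s : ∀ i, CStarState (A i)) : Matrix (ElemTensor A) (ElemTensor A) ℂ :=
  fun a b => ∏ᶠ i, s i (star (a.1 i) * b.1 i)

theorem prodKernel_eq_prod (s : ∀ i, CStarState (A i)) (a b : ElemTensor A) (F : Finset I)
    (ha : ∀ i, i ∉ F → a.1 i = 1) (hb : ∀ i, i ∉ F → b.1 i = 1) :
    prodKernel s a b = ∏ i ∈ F, s i (star (a.1 i) * b.1 i) := by
  refine finprod_eq_prod_of_mulSupport_subset _ fun i hi => ?_
  by_contra h
  exact hi (by simp [ha i h, hb i h])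

theorem exists_finset_support (t : Finset (ElemTensor A)) :
    ∃ F : Finset I, ∀ a ∈ t, ∀ i, i ∉ F → a.1 i = 1 := by
  classical
  refine ⟨t.biUnion fun a => Set.Finite.toFinset (s := {i | a.1 i ≠ 1}) a.2, fun a ha i hi => ?_⟩
  by_contra h
  exact hi (Finset.mem_biUnion.2 ⟨a, ha, (Set.Finite.mem_toFinset _).2 h⟩)

theorem prodKernel_posSemidef (s : ∀ i, CStarState (A i)) : (prodKernel s).PosSemidef := by
  refine .of_finset fun t => ?_
  obtain ⟨F, hF⟩ := exists_finset_support t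
  convert Matrix.PosSemidef.prod' _
    (fun i => (s i).posSemidef_gram fun a : t => a.1.1 i) F using 1
  ext a b
  exact prodKernel_eq_prod s _ _ F (hF _ a.2) (hF _ b.2)

/-- The algebraic GNS space of the product functional `⊗ sᵢ`: formal linear combinations of
elementary tensors, with the semi-inner product given by `⟪⊗ aᵢ, ⊗ bᵢ⟫ = ∏ᵢ sᵢ (aᵢ* bᵢ)`. -/
def PreProdGNS (_s : ∀ i, CStarState (A i)) : Type (max u v) := ElemTensor A →₀ ℂ

variable (s : ∀ i, CStarState (A i))

instance : AddCommGroup (PreProdGNS s) := inferInstanceAs (AddCommGroup (ElemTensor A →₀ ℂ))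
instance : Module ℂ (PreProdGNS s) := inferInstanceAs (Module ℂ (ElemTensor A →₀ ℂ))

/-- The semi-inner product. -/
abbrev preProdGNSCore : PreInnerProductSpace.Core ℂ (PreProdGNS s) where
  inner x y := Finsupp.sum (M := ℂ) x fun a xa => Finsupp.sum (M := ℂ) y fun b yb =>
    star xa * prodKernel s a b * yb
  conj_inner_symm x y := by
    have h : ∀ a b, star (prodKernel s a b) = prodKernel s b a := fun a b =>
      congrFun (congrFun (prodKernel_posSemidef s).1 b) a
    simp only [Finsupp.sum, starRingEnd_apply, star_sum, star_mul', star_star, h]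
    rw [Finset.sum_comm]
    exact Finset.sum_congr rfl fun a _ => Finset.sum_congr rfl fun b _ => by ring
  re_inner_nonneg x := (Complex.nonneg_iff.1 ((prodKernel_posSemidef s).2 x)).1
  add_left x y z := Finsupp.sum_add_index' (by simp [Finsupp.sum])
    (by simp [add_mul, Finsupp.sum, Finset.sum_add_distrib])
  smul_left x y r := by
    refine (Finsupp.sum_smul_index' (by simp [Finsupp.sum])).trans ?_
    simp only [Finsupp.sum, Finset.mul_sum, smul_eq_mul, star_mul', starRingEnd_apply, mul_assoc]

instance : SeminormedAddCommGroup (PreProdGNS s) :=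
  InnerProductSpace.Core.toSeminormedAddCommGroup (c := preProdGNSCore s)
instance : InnerProductSpace ℂ (PreProdGNS s) := InnerProductSpace.ofCore (preProdGNSCore s)

theorem preProdGNS_inner_def (x y : PreProdGNS s) :
    inner ℂ x y = Finsupp.sum (M := ℂ) x fun a xa => Finsupp.sum (M := ℂ) y fun b yb =>
    star xa * prodKernel s a b * yb := rfl

/-- The vector of `PreProdGNS s` given by an elementary tensor. -/
def preVec (a : ElemTensor A) : PreProdGNS s := Finsupp.single a (1 : ℂ)

theorem inner_preVec (a b : ElemTensor A) :
    inner ℂ (preVec s a) (preVec s b) = prodKernel s a b := by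
  rw [preProdGNS_inner_def]
  refine (Finsupp.sum_single_index (by simp [Finsupp.sum])).trans ?_
  refine (Finsupp.sum_single_index (by simp)).trans ?_
  simp

/-- Left multiplication `⊗ aᵢ ↦ ⊗ cᵢ aᵢ` by an elementary tensor. -/
def preMul (c : ElemTensor A) : PreProdGNS s →ₗ[ℂ] PreProdGNS s :=
  Finsupp.lmapDomain ℂ ℂ (fun a => c * a)

theorem inner_preMul_preMul (c : ElemTensor A) (x : PreProdGNS s) :
    inner ℂ (preMul s c x) (preMul s c x) =
      Finsupp.sum (M := ℂ) x fun a xa => Finsupp.sum (M := ℂ) x fun b yb =>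
        star xa * prodKernel s (c * a) (c * b) * yb := by
  rw [preProdGNS_inner_def]
  refine (Finsupp.sum_mapDomain_index (by simp [Finsupp.sum])
    (by simp [add_mul, Finsupp.sum, Finset.sum_add_distrib])).trans ?_
  refine Finset.sum_congr rfl fun a _ => ?_
  exact Finsupp.sum_mapDomain_index (by simp) (by simp [mul_add])

theorem exists_preMul_bound (c : ElemTensor A) :
    ∃ C : ℝ, ∀ (s : ∀ i, CStarState (A i)) (x : PreProdGNS s), ‖preMul s c x‖ ≤ C * ‖x‖ := by
  classical
  obtain ⟨F₀, hF₀⟩ := exists_finset_support {c}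
  refine ⟨∏ i ∈ F₀, ‖c.1 i‖, fun s x => ?_⟩
  have hnt : ∀ i, Nontrivial (A i) := fun i => by
    by_contra h
    rw [not_nontrivial_iff_subsingleton] at h
    have h1 := (s i).map_one
    rw [Subsingleton.elim (1 : A i) 0, map_zero] at h1
    exact zero_ne_one h1
  obtain ⟨F₁, hF₁⟩ := exists_finset_support (Finsupp.support (M := ℂ) x)
  set F := F₀ ∪ F₁ with hF
  have hc : ∀ i, i ∉ F → c.1 i = 1 := fun i hi => hF₀ c (by simp) i (by simp_all)
  have hx : ∀ a ∈ Finsupp.support (M := ℂ) x, ∀ i, i ∉ F → a.1 i = 1 :=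
    fun a ha i hi => hF₁ a ha i (by simp_all)
  have hC : ∏ i ∈ F₀, ‖c.1 i‖ = ∏ i ∈ F, ‖c.1 i‖ := by
    refine Finset.prod_subset Finset.subset_union_left fun i _ hi => ?_
    rw [hF₀ c (by simp) i hi, CStarRing.norm_one]
  have hP := Matrix.PosSemidef.prod_sub _ _
    (fun i => ((s i).posSemidef_gram fun a : ElemTensor A => a.1 i).smul
      (Complex.zero_le_real.2 (sq_nonneg ‖c.1 i‖)))
    (fun i => (s i).posSemidef_gram fun a : ElemTensor A => c.1 i * a.1 i)
    (fun i => (s i).posSemidef_gram_sub (fun a : ElemTensor A => a.1 i) (c.1 i)) F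
  have h0 : 0 ≤ (((∏ i ∈ F, ‖c.1 i‖) ^ 2 : ℝ) : ℂ) * inner ℂ x x
      - inner ℂ (preMul s c x) (preMul s c x) := by
    refine (hP.2 x).trans_eq ?_
    rw [inner_preMul_preMul, preProdGNS_inner_def]
    simp only [Finsupp.sum, Finset.mul_sum, ← Finset.sum_sub_distrib]
    refine Finset.sum_congr rfl fun a ha => Finset.sum_congr rfl fun b hb => ?_
    rw [prodKernel_eq_prod s a b F (hx a ha) (hx b hb),
      prodKernel_eq_prod s (c * a) (c * b) F (fun i hi => by simp [hc i hi, hx a ha i hi])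
        (fun i hi => by simp [hc i hi, hx b hb i hi])]
    simp only [Matrix.of_apply, Matrix.smul_apply, smul_eq_mul, Finset.prod_mul_distrib,
      Finset.prod_pow, Complex.ofReal_pow, Complex.ofReal_prod, Submonoid.coe_mul, Pi.mul_apply]
    ring
  have h1 := (Complex.nonneg_iff.1 h0).1
  rw [inner_self_eq_norm_sq_to_K, inner_self_eq_norm_sq_to_K] at h1
  rw [Complex.sub_re, Complex.re_ofReal_mul] at h1
  norm_cast at h1
  simp only [Complex.coe_algebraMap, Complex.ofReal_re] at h1
  rw [hC]
  refine abs_le_of_sq_le_sq' ?_ (by positivity) |>.2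
  rw [mul_pow]
  linarith

/-- The Hilbert space of the GNS representation of the product functional `⊗ sᵢ`; this is the
Hilbert space tensor product of the GNS spaces of the `sᵢ` (along their cyclic vectors). -/
abbrev ProdGNS : Type (max u v) := UniformSpace.Completion (PreProdGNS s)

/-- The cyclic unit vector `⊗ 1`. -/
def cyclicVec : ProdGNS s := (preVec s 1 : PreProdGNS s)

theorem inner_cyclicVec_self : inner ℂ (cyclicVec s) (cyclicVec s) = (1 : ℂ) := by
  rw [cyclicVec, UniformSpace.Completion.inner_coe, inner_preVec,
    prodKernel_eq_prod s 1 1 ∅ (by simp) (by simp), Finset.prod_empty]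

instance : Nontrivial (ProdGNS s) :=
  ⟨⟨cyclicVec s, 0, fun h => by simpa [h] using inner_cyclicVec_self s⟩⟩

/-- The operator `⊗ᵢ π_{sᵢ}(cᵢ)` of the tensor product of the GNS representations. -/
def elemOp (c : ElemTensor A) : ProdGNS s →L[ℂ] ProdGNS s :=
  ((preMul s c).mkContinuous _ ((exists_preMul_bound c).choose_spec s)).completion

theorem elemOp_preVec (c a : ElemTensor A) :
    elemOp s c (preVec s a : PreProdGNS s) = (preVec s (c * a) : PreProdGNS s) := by
  rw [elemOp, ContinuousLinearMap.completion_apply_coe]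
  congr 1
  exact Finsupp.mapDomain_single

theorem elemOp_one : elemOp s (1 : ElemTensor A) = 1 := by
  ext x
  induction x using UniformSpace.Completion.induction_on with
  | hp => exact isClosed_eq (by fun_prop) (by fun_prop)
  | ih x =>
    rw [elemOp, ContinuousLinearMap.completion_apply_coe]
    congr 1
    change Finsupp.mapDomain (fun a => 1 * a) x = x
    simp only [one_mul]
    exact Finsupp.mapDomain_id

variable (A)

/-- The C*-algebra `∏ₛ B(Hₛ)` of bounded families of operators, where `s` runs over all families
of states `sᵢ` of `Aᵢ` and `Hₛ` is the tensor product of their GNS spaces. -/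
def TensorAmbient : Type (max u v) :=
  lp (fun s : ∀ i, CStarState (A i) => ProdGNS s →L[ℂ] ProdGNS s) ∞

set_option synthInstance.maxHeartbeats 200000 in
instance : CStarAlgebra (TensorAmbient A) :=
  lpInftyCStarAlgebra (fun s : ∀ i, CStarState (A i) => ProdGNS s →L[ℂ] ProdGNS s)

variable {A}

/-- The operator family `(⊗ᵢ π_{sᵢ}(cᵢ))ₛ` of an elementary tensor. -/
def ambientTensor (c : ElemTensor A) : TensorAmbient A :=
  ⟨fun s => elemOp s c, by
    obtain ⟨C, hC⟩ : ∃ C : ℝ, ∀ s : ∀ i, CStarState (A i), ‖elemOp s c‖ ≤ C := by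
      refine ⟨max (exists_preMul_bound c).choose 0, fun s => ?_⟩
      refine ContinuousLinearMap.opNorm_le_bound _ (le_max_right _ _) fun x => ?_
      induction x using UniformSpace.Completion.induction_on with
      | hp => exact isClosed_le (by fun_prop) (by fun_prop)
      | ih x =>
        rw [elemOp, ContinuousLinearMap.completion_apply_coe, UniformSpace.Completion.norm_coe,
          UniformSpace.Completion.norm_coe]
        exact ((exists_preMul_bound c).choose_spec s x).trans
          (mul_le_mul_of_nonneg_right (le_max_left _ _) (norm_nonneg _))
    exact memℓp_infty ⟨C, by rintro _ ⟨s, rfl⟩; exact hC s⟩⟩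

variable (A)

/-- The image of the algebraic tensor product is the `*`-algebra generated by the elementary
tensors; its closure is the minimal tensor product. -/
def minTensorSubalgebra : StarSubalgebra ℂ (TensorAmbient A) :=
  (StarAlgebra.adjoin ℂ (Set.range (ambientTensor (A := A)))).topologicalClosure

/-- The minimal (spatial) C*-tensor product `⊗ᵢ Aᵢ` of a finite or infinite family of unital
C*-algebras: the completion of the algebraic tensor product in the norm
`‖x‖ = sup ‖(⊗ᵢ π_{sᵢ})(x)‖`, the supremum over all families of states `sᵢ` of `Aᵢ`.
(For each `i` the direct sum of all GNS representations of `Aᵢ` is faithful.) -/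
def MinTensor : Type (max u v) := minTensorSubalgebra A

/-- The closed `*`-subalgebra `minTensorSubalgebra A` is a C*-algebra. -/
def minTensorCStarAlgebra : CStarAlgebra (minTensorSubalgebra A) :=
  StarSubalgebra.cstarAlgebra (minTensorSubalgebra A)
    (h_closed := StarSubalgebra.isClosed_topologicalClosure _)

instance : CStarAlgebra (MinTensor A) := minTensorCStarAlgebra A

variable {A}

/-- The elementary tensor `⊗ᵢ cᵢ` in `⊗ᵢ Aᵢ`. -/
def MinTensor.tmul (c : ElemTensor A) : MinTensor A :=
  (⟨ambientTensor c, StarSubalgebra.le_topologicalClosure _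
    (StarAlgebra.subset_adjoin ℂ _ ⟨c, rfl⟩)⟩ : minTensorSubalgebra A)

/-- The product state `⊗ᵢ sᵢ` on `⊗ᵢ Aᵢ`. -/
def productState : CStarState (MinTensor A) where
  toFun x := inner ℂ (cyclicVec s) ((x : minTensorSubalgebra A).1.1 s (cyclicVec s))
  map_add' x y := inner_add_right _ _ _
  map_smul' r x := inner_smul_right (𝕜 := ℂ) _ _ _
  nonneg' x := by
    set T : ProdGNS s →L[ℂ] ProdGNS s := (x : minTensorSubalgebra A).1.1 s
    change 0 ≤ inner ℂ (cyclicVec s) ((star T * T) (cyclicVec s))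
    rw [ContinuousLinearMap.star_eq_adjoint, mul_apply_eq_comp,
      ContinuousLinearMap.adjoint_inner_right, inner_self_eq_norm_sq_to_K]
    refine le_of_le_of_eq (Complex.zero_le_real.2 (sq_nonneg ‖T (cyclicVec s)‖)) ?_
    simp
  map_one' := inner_cyclicVec_self s

theorem productState_tmul (c : ElemTensor A) :
    productState s (MinTensor.tmul c) = ∏ᶠ i, s i (c.1 i) := by
  change inner ℂ (cyclicVec s) (elemOp s c (cyclicVec s)) = _
  rw [cyclicVec, elemOp_preVec, UniformSpace.Completion.inner_coe, inner_preVec]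
  simp [prodKernel]

/-- For C*-subalgebras `Bᵢ ⊆ Aᵢ`, the C*-subalgebra `⊗ᵢ Bᵢ ⊆ ⊗ᵢ Aᵢ`: the closure of the
`*`-algebra generated by the elementary tensors `⊗ bᵢ` with `bᵢ ∈ Bᵢ`. -/
def subTensor (B : ∀ i, StarSubalgebra ℂ (A i)) : StarSubalgebra ℂ (MinTensor A) :=
  (StarAlgebra.adjoin ℂ {x | ∃ c : ElemTensor A, (∀ i, c.1 i ∈ B i) ∧
    MinTensor.tmul c = x}).topologicalClosure

end MinTensor

section Inclusions

universe u

variable {A : Type u} [CStarAlgebra A]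

/-- Simplicity of a unital C*-algebra: it is non-zero and has no closed two-sided ideals other
than `0` and itself. -/
def IsSimpleCStar (R : Type*) [Ring R] [TopologicalSpace R] : Prop :=
  Nontrivial R ∧ ∀ J : TwoSidedIdeal R, IsClosed (J : Set R) → J = ⊥ ∨ J = ⊤

/-- A unital inclusion `B ⊆ A` is C*-irreducible if every C*-algebra `D` with `B ⊆ D ⊆ A` is
simple; `D = B` and `D = A` are allowed. -/
def IsCStarIrreducible (B : StarSubalgebra ℂ A) : Prop :=
  IsSimpleCStar A ∧ IsSimpleCStar B ∧
    ∀ D : StarSubalgebra ℂ A, IsClosed (D : Set A) → B ≤ D → IsSimpleCStar D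

/-- `C_B(a)`: the closed convex hull of the orbit `{u* a u}`, `u` running over the unitaries
of `B`. -/
def dixmierSet (B : StarSubalgebra ℂ A) (a : A) : Set A :=
  closure (convexHull ℝ {x | ∃ u ∈ unitary A, u ∈ B ∧ x = star u * a * u})

/-- The relative Dixmier property of `B ⊆ A`: `C_B(a)` meets the scalars for all `a ∈ A`. -/
def HasRelativeDixmier (B : StarSubalgebra ℂ A) : Prop :=
  ∀ a : A, (dixmierSet B a ∩ Set.range (algebraMap ℂ A)).Nonempty

/-- The relative excision property of `B ⊆ A` with respect to a state `ψ`: there is a net `h` of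
positive norm-one elements of `B` with `‖h^{1/2} a h^{1/2} - ψ(a) h‖ → 0` for all `a ∈ A`. -/
def HasRelativeExcision (B : StarSubalgebra ℂ A) (ψ : CStarState A) : Prop :=
  ∃ (Λ : Type u) (_ : Preorder Λ) (_ : IsDirected Λ (· ≤ ·)) (_ : Nonempty Λ) (h : Λ → A),
    (∀ l, h l ∈ B ∧ (∃ k : A, h l = star k * k) ∧ ‖h l‖ = 1) ∧
    ∀ a : A, Filter.Tendsto
      (fun l => ‖cfc Real.sqrt (h l) * a * cfc Real.sqrt (h l) - ψ a • h l‖)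
      Filter.atTop (nhds 0)

end Inclusions

end

/-! Elementary tensors span a dense subspace and are multilinear in their coordinates. Estimates are
therefore made on elementary tensors, one coordinate at a time, and pass to the closure because all
maps involved are contractive.

Faithfulness. Suppose the product state kills `x* x`. Fixing all states but the one at `j` slices
`x* x` to a positive `e` in `A j` with `ψ j e = 0`. Then `e = 0`, so the state at `j` may be
replaced by any other (`productState_update_eq_zero`). After finitely many replacements and a limit,
every product state kills `x* x`. Vector states at elementary tensors are multiples of product
states, so `x` acts as zero in every representation.

Dixmier property. A convex combination of unitary conjugations at coordinate `j` lifts to the tensor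
product. Such maps are unital, contractive and trace preserving, so finitely many elements can be
averaged by the same map, and then coordinate after coordinate (`exists_averaging_eraseOn`). The
trace is constant on a Dixmier set, hence determines the scalar. If an ideal of an intermediate
algebra contains `x* x ≠ 0`, its closure contains the scalar `τ (x* x) ≠ 0`.

Excision. A tensor of coordinatewise excising elements excises the product state, by a telescoping
estimate and because square roots are taken coordinatewise. For irreducibility, an ideal containing
`x* x` contains `h^{1/2} x* x h^{1/2}`, which is close to `ψ (x* x) h`. It remains to move `h` close
to `1` by a unital map `y ↦ ∑ b* y b` with `b` in `⊗ B i`. In a simple `B j`, let `g` be a function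
of `h` supported near the spectral value `1`. Since `g²` generates the whole algebra, `∑ b* g² b =
1` for suitable `b`, and then `∑ b* g h g b` is close to `1`
(`IsSimpleCStar.exists_conjSum_near_one`). Being positive and unital, these maps do not enlarge the
excision error, however many summands they have. -/

noncomputable section

open scoped ComplexOrder ENNReal

/-! ### Algebra of elementary tensors and density of their span -/

section MinTensorAPI

universe u v

variable {I : Type u} {A : I → Type v} [∀ i, CStarAlgebra (A i)]

namespace ElemTensor

instance : Star (ElemTensor A) :=
  ⟨fun c => ⟨fun i => star (c.1 i), c.2.subset fun i hi h => hi (by simp [h])⟩⟩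

@[simp] theorem star_apply (c : ElemTensor A) (i : I) : (star c).1 i = star (c.1 i) := rfl

@[simp] theorem mul_apply (c d : ElemTensor A) (i : I) : (c * d).1 i = c.1 i * d.1 i := rfl

@[simp] theorem one_apply (i : I) : (1 : ElemTensor A).1 i = 1 := rfl

theorem ext' {c d : ElemTensor A} (h : ∀ i, c.1 i = d.1 i) : c = d := Subtype.ext (funext h)

theorem exists_finset (c : ElemTensor A) : ∃ F : Finset I, ∀ i, i ∉ F → c.1 i = 1 :=
  (exists_finset_support {c}).imp fun _ hF => hF c (by simp)

open Classical in
/-- Replacement of the coordinate `j` of an elementary tensor. -/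
def update (c : ElemTensor A) (j : I) (a : A j) : ElemTensor A :=
  ⟨Function.update c.1 j a, (c.2.union (Set.finite_singleton j)).subset fun i hi => by
    by_cases h : i = j
    · exact Or.inr h
    · refine Or.inl ?_
      simpa [Function.update_of_ne h] using hi⟩

@[simp] theorem update_same (c : ElemTensor A) (j : I) (a : A j) :
    (ElemTensor.update c j a).1 j = a := by
  simp [update]

theorem update_of_ne (c : ElemTensor A) {i j : I} (h : i ≠ j) (a : A j) :
    (ElemTensor.update c j a).1 i = c.1 i := by
  classical exact Function.update_of_ne h a c.1

theorem update_eq_self (c : ElemTensor A) (j : I) : ElemTensor.update c j (c.1 j) = c := by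
  simp [update]

theorem update_mul_update (c d : ElemTensor A) (j : I) (a b : A j) :
    ElemTensor.update c j a * ElemTensor.update d j b = ElemTensor.update (c * d) j (a * b) := by
  refine ext' fun i => ?_
  by_cases h : i = j
  · subst h; simp
  · simp [update_of_ne _ h]

theorem star_update (c : ElemTensor A) (j : I) (a : A j) :
    star (ElemTensor.update c j a) = ElemTensor.update (star c) j (star a) := by
  refine ext' fun i => ?_
  by_cases h : i = j
  · subst h; simp
  · simp [update_of_ne _ h]

end ElemTensor

section Rep

variable (s : ∀ i, CStarState (A i))

theorem preVec_span : Submodule.span ℂ (Set.range (preVec s)) = ⊤ := by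
  refine eq_top_iff.2 fun x _ => ?_
  induction x using Finsupp.induction_linear with
  | zero => exact zero_mem _
  | add x y hx hy => exact add_mem (hx trivial) (hy trivial)
  | single a z =>
    have : (Finsupp.single a z : ElemTensor A →₀ ℂ) = z • Finsupp.single a 1 := by simp
    rw [this]
    exact Submodule.smul_mem _ z (Submodule.subset_span ⟨a, rfl⟩)

theorem ProdGNS.dense_span : Dense (Submodule.span ℂ
    (Set.range fun a => ((preVec s a : PreProdGNS s) : ProdGNS s)) : Set (ProdGNS s)) := by
  have h : (Set.range ((↑) : PreProdGNS s → ProdGNS s)) ⊆ Submodule.span ℂ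
      (Set.range fun a => ((preVec s a : PreProdGNS s) : ProdGNS s)) := by
    rintro _ ⟨x, rfl⟩
    have hx : x ∈ Submodule.span ℂ (Set.range (preVec s)) := by rw [preVec_span]; trivial
    induction hx using Submodule.span_induction with
    | mem x hx => obtain ⟨a, rfl⟩ := hx; exact Submodule.subset_span ⟨a, rfl⟩
    | zero => rw [UniformSpace.Completion.coe_zero]; exact zero_mem _
    | add x y _ _ hx hy => rw [UniformSpace.Completion.coe_add]; exact add_mem hx hy
    | smul z x _ hx => rw [UniformSpace.Completion.coe_smul]; exact Submodule.smul_mem _ z hx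
  exact UniformSpace.Completion.denseRange_coe.mono h

theorem ProdGNS.vec_eq_zero {x : ProdGNS s}
    (h : ∀ a, inner ℂ ((preVec s a : PreProdGNS s) : ProdGNS s) x = 0) : x = 0 := by
  refine (ProdGNS.dense_span s).eq_zero_of_inner_right ℂ fun v hv => ?_
  induction hv using Submodule.span_induction with
  | mem x hx => obtain ⟨a, rfl⟩ := hx; exact h a
  | zero => simp
  | add x y hx hy h1 h2 => simp_all [inner_add_left]
  | smul z x hx h1 => simp_all [inner_smul_left]

theorem ProdGNS.op_ext_vec {T T' : ProdGNS s →L[ℂ] ProdGNS s}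
    (h : ∀ b, T (preVec s b : PreProdGNS s) = T' (preVec s b : PreProdGNS s)) : T = T' :=
  ContinuousLinearMap.ext_on (ProdGNS.dense_span s) (by rintro _ ⟨b, rfl⟩; exact h b)

theorem ProdGNS.op_ext {T T' : ProdGNS s →L[ℂ] ProdGNS s}
    (h : ∀ a b, inner ℂ ((preVec s a : PreProdGNS s) : ProdGNS s) (T (preVec s b : PreProdGNS s))
      = inner ℂ ((preVec s a : PreProdGNS s) : ProdGNS s) (T' (preVec s b : PreProdGNS s))) :
    T = T' :=
  ProdGNS.op_ext_vec s fun b => sub_eq_zero.1 <| ProdGNS.vec_eq_zero s fun a => by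
    rw [inner_sub_right, h, sub_self]

theorem inner_elemOp (a b c : ElemTensor A) :
    inner ℂ ((preVec s a : PreProdGNS s) : ProdGNS s) (elemOp s c (preVec s b : PreProdGNS s))
      = prodKernel s a (c * b) := by
  rw [elemOp_preVec, UniformSpace.Completion.inner_coe, inner_preVec]

theorem elemOp_mul (c d : ElemTensor A) : elemOp s (c * d) = elemOp s c * elemOp s d := by
  refine ProdGNS.op_ext_vec s fun b => ?_
  change _ = elemOp s c (elemOp s d _)
  simp only [elemOp_preVec, mul_assoc]

theorem elemOp_star (c : ElemTensor A) : elemOp s (star c) = star (elemOp s c) := by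
  refine ProdGNS.op_ext s fun a b => ?_
  rw [ContinuousLinearMap.star_eq_adjoint, ContinuousLinearMap.adjoint_inner_right, inner_elemOp,
    elemOp_preVec, UniformSpace.Completion.inner_coe, inner_preVec]
  simp [prodKernel, mul_assoc]

/-- Every factor of the product except the one at `j` is independent of `x`. The kernel is thus
linear in coordinate `j`, which makes elementary tensors multilinear. -/
theorem prodKernel_update (j : I) (a b c : ElemTensor A) : ∃ z : ℂ, ∀ x : A j,
    prodKernel s a (ElemTensor.update c j x * b) = z * s j (star (a.1 j) * (x * b.1 j)) := by
  classical
  obtain ⟨F₁, h₁⟩ := ElemTensor.exists_finset a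
  obtain ⟨F₂, h₂⟩ := ElemTensor.exists_finset b
  obtain ⟨F₃, h₃⟩ := ElemTensor.exists_finset c
  set F := insert j (F₁ ∪ F₂ ∪ F₃) with hF
  refine ⟨∏ i ∈ F.erase j, s i (star (a.1 i) * (c.1 i * b.1 i)), fun x => ?_⟩
  rw [prodKernel_eq_prod s a _ F (fun i hi => h₁ i (by simp_all)), ← Finset.mul_prod_erase F _
    (Finset.mem_insert_self j _), mul_comm]
  · congr 1
    · refine Finset.prod_congr rfl fun i hi => ?_
      simp [ElemTensor.update_of_ne c (Finset.ne_of_mem_erase hi)]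
    · simp
  · intro i hi
    have hij : i ≠ j := by rintro rfl; simp [hF] at hi
    simp only [hF, Finset.mem_insert, Finset.mem_union, not_or] at hi
    simp [ElemTensor.update_of_ne c hij, h₂ i hi.2.1.2, h₃ i hi.2.2]

theorem elemOp_update_add (c : ElemTensor A) (j : I) (x y : A j) :
    elemOp s (ElemTensor.update c j (x + y)) = elemOp s (ElemTensor.update c j x) + elemOp s (ElemTensor.update c j y) := by
  refine ProdGNS.op_ext s fun a b => ?_
  obtain ⟨z, hz⟩ := prodKernel_update s j a b c
  rw [add_apply, inner_add_right, inner_elemOp, inner_elemOp, inner_elemOp,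
    hz, hz, hz]
  simp [add_mul, mul_add]

theorem elemOp_update_smul (c : ElemTensor A) (j : I) (r : ℂ) (x : A j) :
    elemOp s (ElemTensor.update c j (r • x)) = r • elemOp s (ElemTensor.update c j x) := by
  refine ProdGNS.op_ext s fun a b => ?_
  obtain ⟨z, hz⟩ := prodKernel_update s j a b c
  rw [smul_apply, inner_smul_right, inner_elemOp, inner_elemOp, hz, hz]
  simp
  ring

end Rep

namespace MinTensor

/-- The representation of `⊗ᵢ Aᵢ` on the tensor product of the GNS spaces of the `sᵢ`. -/
def rep (s : ∀ i, CStarState (A i)) : MinTensor A →⋆ₐ[ℂ] (ProdGNS s →L[ℂ] ProdGNS s) where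
  toFun x := (x : minTensorSubalgebra A).1.1 s
  map_one' := rfl
  map_mul' _ _ := rfl
  map_zero' := rfl
  map_add' _ _ := rfl
  commutes' _ := rfl
  map_star' _ := rfl

theorem ext_rep {x y : MinTensor A} (h : ∀ s, rep s x = rep s y) : x = y :=
  Subtype.ext (lp.ext (funext h))

theorem rep_tmul (s : ∀ i, CStarState (A i)) (c : ElemTensor A) : rep s (tmul c) = elemOp s c := rfl

theorem tmul_mul (c d : ElemTensor A) : tmul (c * d) = tmul c * tmul d :=
  ext_rep fun s => by rw [map_mul]; exact elemOp_mul s c d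

theorem tmul_star (c : ElemTensor A) : tmul (star c) = star (tmul c) :=
  ext_rep fun s => by rw [map_star]; exact elemOp_star s c

theorem tmul_one : tmul (1 : ElemTensor A) = 1 :=
  ext_rep fun s => by rw [map_one]; exact elemOp_one s

theorem tmul_update_add (c : ElemTensor A) (j : I) (x y : A j) :
    tmul (ElemTensor.update c j (x + y)) = tmul (ElemTensor.update c j x) + tmul (ElemTensor.update c j y) :=
  ext_rep fun s => by rw [map_add (rep s)]; exact elemOp_update_add s c j x y

theorem tmul_update_smul (c : ElemTensor A) (j : I) (r : ℂ) (x : A j) :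
    tmul (ElemTensor.update c j (r • x)) = r • tmul (ElemTensor.update c j x) :=
  ext_rep fun s => by rw [map_smul (rep s)]; exact elemOp_update_smul s c j r x

/-- The embedding of a tensor factor. -/
def incl (j : I) : A j →⋆ₐ[ℂ] MinTensor A where
  toFun x := tmul (ElemTensor.update (1 : ElemTensor A) j x)
  map_one' := (congrArg tmul (ElemTensor.update_eq_self (1 : ElemTensor A) j)).trans tmul_one
  map_mul' x y := by rw [← tmul_mul, ElemTensor.update_mul_update, mul_one]
  map_zero' := by
    have := tmul_update_smul (1 : ElemTensor A) j 0 0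
    rwa [zero_smul, zero_smul] at this
  map_add' x y := tmul_update_add 1 j x y
  commutes' r := by
    rw [Algebra.algebraMap_eq_smul_one, Algebra.algebraMap_eq_smul_one, tmul_update_smul]
    congr 1
    exact (congrArg tmul (ElemTensor.update_eq_self (1 : ElemTensor A) j)).trans tmul_one
  map_star' x := by
    rw [← tmul_star, ElemTensor.star_update]
    congr 2
    exact ElemTensor.ext' fun i => by simp

theorem incl_apply (j : I) (x : A j) : incl j x = tmul (ElemTensor.update (1 : ElemTensor A) j x) := rfl

/-- Splits off one coordinate as a factor in the image of the contraction `incl j`, so that norm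
estimates can be made coordinate by coordinate. -/
theorem tmul_update (c : ElemTensor A) (j : I) (x : A j) :
    tmul (ElemTensor.update c j x) = tmul (ElemTensor.update c j 1) * incl j x := by
  rw [incl_apply, ← tmul_mul, ElemTensor.update_mul_update, mul_one, one_mul]

theorem norm_incl_le (j : I) (x : A j) : ‖(incl j x : MinTensor A)‖ ≤ ‖x‖ :=
  NonUnitalStarAlgHom.norm_apply_le (incl j : A j →⋆ₐ[ℂ] MinTensor A) x

/-- Elementary tensors contain `1` and are closed under products and adjoints, so their span is
already a `*`-algebra. -/
theorem adjoin_ambientTensor_le : ((StarAlgebra.adjoin ℂ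
    (Set.range (ambientTensor (A := A)))).toSubalgebra.toSubmodule : Submodule ℂ (TensorAmbient A))
      ≤ Submodule.span ℂ (Set.range (ambientTensor (A := A))) := by
  intro x hx
  change x ∈ StarAlgebra.adjoin ℂ _ at hx
  induction hx using StarAlgebra.adjoin_induction with
  | mem x hx => exact Submodule.subset_span hx
  | algebraMap r =>
    rw [Algebra.algebraMap_eq_smul_one]
    refine Submodule.smul_mem _ r (Submodule.subset_span ⟨1, ?_⟩)
    exact congrArg (fun x : minTensorSubalgebra A => x.1) (tmul_one (A := A))
  | add x y _ _ hx hy => exact add_mem hx hy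
  | mul x y _ _ hx hy =>
    have := Submodule.mul_mem_mul hx hy
    rw [Submodule.span_mul_span] at this
    refine Submodule.span_mono ?_ this
    rintro _ ⟨_, ⟨c, rfl⟩, _, ⟨d, rfl⟩, rfl⟩
    exact ⟨c * d, congrArg (fun x : minTensorSubalgebra A => x.1) (tmul_mul c d)⟩
  | star x hx0 hx =>
    clear hx0
    induction hx using Submodule.span_induction with
    | mem x hx =>
      obtain ⟨c, rfl⟩ := hx
      exact Submodule.subset_span
        ⟨star c, congrArg (fun x : minTensorSubalgebra A => x.1) (tmul_star c)⟩
    | zero => simp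
    | add x y _ _ hx hy => rw [star_add]; exact add_mem hx hy
    | smul z x _ hx => rw [star_smul]; exact Submodule.smul_mem _ _ hx

theorem dense_span_tmul : Dense (Submodule.span ℂ (Set.range (tmul (A := A))) :
    Set (MinTensor A)) := by
  intro x
  have h : ((StarAlgebra.adjoin ℂ (Set.range (ambientTensor (A := A)))) :
      Set (TensorAmbient A)) ⊆ (fun x : MinTensor A => (x : minTensorSubalgebra A).1) ''
        (Submodule.span ℂ (Set.range (tmul (A := A))) : Set (MinTensor A)) := by
    intro y hy
    replace hy := adjoin_ambientTensor_le hy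
    induction hy using Submodule.span_induction with
    | mem x hx => obtain ⟨c, rfl⟩ := hx; exact ⟨tmul c, Submodule.subset_span ⟨c, rfl⟩, rfl⟩
    | zero => exact ⟨0, zero_mem _, rfl⟩
    | add x y _ _ hx hy =>
      obtain ⟨x', hx, rfl⟩ := hx
      obtain ⟨y', hy, rfl⟩ := hy
      exact ⟨_, add_mem hx hy, rfl⟩
    | smul z x _ hx =>
      obtain ⟨x', hx, rfl⟩ := hx
      exact ⟨_, Submodule.smul_mem _ z hx, rfl⟩
  refine (closure_subtype (x := (x : minTensorSubalgebra A))
    (s := (Submodule.span ℂ (Set.range (tmul (A := A))) : Set (MinTensor A)))).2 ?_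
  exact closure_mono h (x : minTensorSubalgebra A).2

@[elab_as_elim]
theorem induction_on {p : MinTensor A → Prop} (x : MinTensor A)
    (hc : IsClosed {x | p x}) (ht : ∀ c, p (tmul c)) (ha : ∀ x y, p x → p y → p (x + y))
    (hs : ∀ (r : ℂ) x, p x → p (r • x)) : p x := by
  have h : (Submodule.span ℂ (Set.range (tmul (A := A))) : Set (MinTensor A)) ⊆ {x | p x} := by
    intro y hy
    induction hy using Submodule.span_induction with
    | mem x hx => obtain ⟨c, rfl⟩ := hx; exact ht c
    | zero => have := hs 0 _ (ht 1); rwa [zero_smul] at this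
    | add x y _ _ hx hy => exact ha _ _ hx hy
    | smul z x _ hx => exact hs _ _ hx
  exact closure_minimal h hc (dense_span_tmul x)

end MinTensor

end MinTensorAPI

/-! ### States detect positivity and the norm -/

section States

variable {A : Type*} [CStarAlgebra A]

theorem IsSelfAdjoint.norm_le_of_mem_Icc [PartialOrder A] [StarOrderedRing A] {e : A} {c : ℝ}
    (he : IsSelfAdjoint e) (hc : 0 ≤ c) (h₁ : -algebraMap ℝ A c ≤ e) (h₂ : e ≤ algebraMap ℝ A c) :
    ‖e‖ ≤ c := by
  cases subsingleton_or_nontrivial A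
  · rw [Subsingleton.elim e 0, norm_zero]; exact hc
  · rw [← map_neg] at h₁
    rcases CStarAlgebra.norm_or_neg_norm_mem_spectrum he with h | h
    · exact (le_algebraMap_iff_spectrum_le he).1 h₂ _ h
    · exact neg_le_neg_iff.1 ((algebraMap_le_iff_le_spectrum he).1 h₁ _ h)

namespace CStarState

/-- The Gram matrix of the elements of the algebra is Hermitian; this is its entry at `a` and `1`.
-/
theorem map_star (φ : CStarState A) (a : A) : φ (star a) = star (φ a) := by
  have := (φ.posSemidef_gram (id : A → A)).1.apply a 1
  simpa using this.symm

theorem re_sq_nonneg (φ : CStarState A) (a : A) : 0 ≤ (φ (star a * a)).re :=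
  (Complex.nonneg_iff.1 (φ.nonneg a)).1

theorem map_star_mul_self (φ : CStarState A) (a : A) :
    φ (star a * a) = ((φ (star a * a)).re : ℂ) :=
  Complex.ext rfl (by simpa using (Complex.nonneg_iff.1 (φ.nonneg a)).2.symm)

theorem map_nonneg [PartialOrder A] [StarOrderedRing A] (φ : CStarState A) {a : A} (ha : 0 ≤ a) :
    0 ≤ φ a := by
  obtain ⟨b, rfl⟩ := CStarAlgebra.nonneg_iff_eq_star_mul_self.1 ha
  exact φ.nonneg b

theorem map_algebraMap (φ : CStarState A) (z : ℂ) : φ (algebraMap ℂ A z) = z := by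
  rw [Algebra.algebraMap_eq_smul_one, map_smul, map_one, smul_eq_mul, mul_one]

theorem map_star_mul_self_le (φ : CStarState A) (a : A) : (φ (star a * a)).re ≤ ‖a‖ ^ 2 := by
  let _ := CStarAlgebra.spectralOrder A
  have _ := CStarAlgebra.spectralOrderedRing A
  have h := φ.map_nonneg (sub_nonneg.2 (CStarAlgebra.star_mul_le_algebraMap_norm_sq (a := a)))
  rw [map_sub, Algebra.algebraMap_eq_smul_one, ← Complex.coe_smul, map_smul, map_one] at h
  have := (Complex.nonneg_iff.1 h).1
  rw [smul_eq_mul, mul_one, Complex.sub_re, Complex.ofReal_re] at this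
  linarith

/-- The variance `φ (a* a) - |φ a|²` is the value of `φ` at a positive element, and `φ (a* a) ≤
‖a‖²`. -/
theorem norm_apply_le (φ : CStarState A) (a : A) : ‖φ a‖ ≤ ‖a‖ := by
  have h := φ.re_sq_nonneg (a - φ a • 1)
  have e : φ (star (a - φ a • 1) * (a - φ a • 1)) = φ (star a * a) - star (φ a) * φ a := by
    simp only [star_sub, star_smul, star_one, sub_mul, mul_sub, map_sub, smul_mul_assoc,
      mul_smul_comm, one_mul, mul_one, map_smul, smul_eq_mul, map_one, map_star]
    ring
  have e' : star (φ a) * φ a = ((‖φ a‖ ^ 2 : ℝ) : ℂ) := by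
    rw [Complex.star_def, mul_comm, Complex.mul_conj, Complex.normSq_eq_norm_sq]
  rw [e, e', Complex.sub_re, Complex.ofReal_re] at h
  exact abs_le_of_sq_le_sq' (by linarith [φ.map_star_mul_self_le a]) (norm_nonneg _) |>.2

theorem continuous (φ : CStarState A) : Continuous φ :=
  (φ.toLinearMap.mkContinuous 1 fun x => by rw [one_mul]; exact φ.norm_apply_le x).continuous

/-- Hahn–Banach separation of `y` from the closed positive cone, followed by complexification and
normalisation at `1`. -/
theorem exists_re_neg [PartialOrder A] [StarOrderedRing A] {y : A} (hy : IsSelfAdjoint y)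
    (hn : ¬ 0 ≤ y) : ∃ φ : CStarState A, (φ y).re < 0 := by
  have : OrderClosedTopology A := inferInstance
  obtain ⟨f, hf, hfy⟩ := (ProperCone.positive ℝ A).hyperplane_separation_point (x₀ := y) hn
  replace hf : ∀ x : A, 0 ≤ x → 0 ≤ f x := hf
  -- If `f 1 = 0`, positivity of `y + ‖y‖` would give `f y ≥ 0`.
  have h1 : 0 < f 1 := by
    refine lt_of_le_of_ne (hf 1 zero_le_one) fun h => ?_
    have h2 := hf _ (sub_nonneg.2 hy.neg_algebraMap_norm_le_self)
    rw [sub_neg_eq_add, map_add, Algebra.algebraMap_eq_smul_one, map_smul, ← h] at h2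
    simp at h2
    linarith
  -- The separating `f` is only real-linear and arbitrary on skew-adjoint elements. After passing to
  -- real parts, its complexification agrees with `f` on self-adjoint elements.
  let g : Module.Dual ℝ A := f.toLinearMap ∘ₗ (selfAdjoint.submodule ℝ A).subtype ∘ₗ realPart
  have hg : ∀ x : A, g x = f (realPart x : A) := fun _ => rfl
  have hgs : ∀ x : A, IsSelfAdjoint x →
      (g.extendRCLike : Module.Dual ℂ A) x = (f x : ℂ) := fun x hx => by
    have h0 : g (Complex.I • x) = 0 := by rw [hg, realPart_I_smul, hx.imaginaryPart]; simp
    have h1 : g x = f x := by rw [hg, hx.coe_realPart]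
    refine (Module.Dual.extendRCLike_apply g x).trans ?_
    change (g x : ℂ) - Complex.I * (g (Complex.I • x) : ℂ) = _
    rw [h0, h1]
    simp
  refine ⟨⟨((f 1)⁻¹ : ℂ) • g.extendRCLike, fun a => ?_, ?_⟩, ?_⟩
  · rw [LinearMap.smul_apply, hgs _ (IsSelfAdjoint.star_mul_self a), smul_eq_mul]
    have := hf _ (star_mul_self_nonneg a)
    exact_mod_cast mul_nonneg (inv_nonneg.2 h1.le) this
  · rw [LinearMap.smul_apply, hgs _ (IsSelfAdjoint.one A), smul_eq_mul]
    exact inv_mul_cancel₀ (by exact_mod_cast h1.ne')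
  · change ((((f 1)⁻¹ : ℂ) • (g.extendRCLike : Module.Dual ℂ A)) y).re < 0
    rw [LinearMap.smul_apply, hgs _ hy, smul_eq_mul]
    norm_cast
    exact mul_neg_of_pos_of_neg (inv_pos.2 h1) hfy

theorem nonneg_of_forall_re [PartialOrder A] [StarOrderedRing A] {y : A} (hy : IsSelfAdjoint y)
    (h : ∀ φ : CStarState A, 0 ≤ (φ y).re) : 0 ≤ y := by
  by_contra hn
  obtain ⟨φ, hφ⟩ := exists_re_neg hy hn
  exact (h φ).not_gt hφ

theorem norm_le_of_forall_isSelfAdjoint {e : A} (he : IsSelfAdjoint e) {c : ℝ} (hc : 0 ≤ c)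
    (h : ∀ φ : CStarState A, |(φ e).re| ≤ c) : ‖e‖ ≤ c := by
  let _ := CStarAlgebra.spectralOrder A
  have _ := CStarAlgebra.spectralOrderedRing A
  have hsa : IsSelfAdjoint (algebraMap ℝ A c) := .algebraMap _ (.all c)
  have hm : ∀ φ : CStarState A, (φ (algebraMap ℝ A c)).re = c := fun φ => by
    rw [IsScalarTower.algebraMap_apply ℝ ℂ A, map_algebraMap]; simp
  refine he.norm_le_of_mem_Icc hc (neg_le_iff_add_nonneg.2 ?_) (sub_nonneg.1 ?_)
  · refine nonneg_of_forall_re (he.add hsa) fun φ => ?_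
    rw [map_add, Complex.add_re, hm]
    linarith [(abs_le.1 (h φ)).1]
  · refine nonneg_of_forall_re (hsa.sub he) fun φ => ?_
    rw [map_sub, Complex.sub_re, hm]
    linarith [(abs_le.1 (h φ)).2]

theorem map_realPart (φ : CStarState A) (a : A) : (φ (realPart a : A)) = ((φ a).re : ℂ) := by
  rw [realPart_apply_coe, ← Complex.coe_smul, map_smul, map_add, map_star]
  apply Complex.ext <;> simp
  ring

theorem map_imaginaryPart (φ : CStarState A) (a : A) :
    (φ (imaginaryPart a : A)) = ((φ a).im : ℂ) := by
  rw [imaginaryPart_apply_coe, ← Complex.coe_smul, map_smul, map_smul, map_sub, map_star]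
  apply Complex.ext <;> simp
  ring

/-- The factor `2` comes from treating real and imaginary parts separately; it is harmless in the
Cauchy estimate for slices. -/
theorem norm_le_two_mul {e : A} {c : ℝ} (hc : 0 ≤ c) (h : ∀ φ : CStarState A, ‖φ e‖ ≤ c) :
    ‖e‖ ≤ 2 * c := by
  have h1 : ‖(realPart e : A)‖ ≤ c := norm_le_of_forall_isSelfAdjoint (realPart e).2 hc fun φ => by
    rw [map_realPart, Complex.ofReal_re]
    exact (Complex.abs_re_le_norm _).trans (h φ)
  have h2 : ‖(imaginaryPart e : A)‖ ≤ c :=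
    norm_le_of_forall_isSelfAdjoint (imaginaryPart e).2 hc fun φ => by
      rw [map_imaginaryPart, Complex.ofReal_re]
      exact (Complex.abs_im_le_norm _).trans (h φ)
  rw [← realPart_add_I_smul_imaginaryPart e]
  refine (norm_add_le _ _).trans ?_
  rw [norm_smul, Complex.norm_I]
  linarith

theorem nonneg_of_forall [PartialOrder A] [StarOrderedRing A] {y : A}
    (h : ∀ φ : CStarState A, 0 ≤ φ y) : 0 ≤ y := by
  have hi : (imaginaryPart y : A) = 0 := by
    refine norm_le_zero_iff.1 (norm_le_of_forall_isSelfAdjoint (imaginaryPart y).2 le_rfl fun φ => ?_)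
    rw [map_imaginaryPart, ← (Complex.nonneg_iff.1 (h φ)).2]
    simp
  have hy : IsSelfAdjoint y := by
    rw [← realPart_add_I_smul_imaginaryPart y, hi, smul_zero, add_zero]
    exact (realPart y).2
  exact nonneg_of_forall_re hy fun φ => (Complex.nonneg_iff.1 (h φ)).1

/-- A positive element of norm one has states with values close to `1`. -/
theorem exists_lt_re {k : A} (hk : ‖star k * k‖ = 1) {r : ℝ} (h0 : 0 ≤ r) (hr : r < 1) :
    ∃ φ : CStarState A, r < (φ (star k * k)).re := by
  by_contra! hn
  refine (hk ▸ hr).not_ge (norm_le_of_forall_isSelfAdjoint (.star_mul_self k) h0 fun φ => ?_)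
  rw [abs_of_nonneg (φ.re_sq_nonneg k)]
  exact hn φ

/-- The state `x ↦ φ (a* x a) / φ (a* a)`. -/
def conj (φ : CStarState A) (a : A) (ha : φ (star a * a) ≠ 0) : CStarState A where
  toLinearMap := (φ (star a * a))⁻¹ • φ.toLinearMap ∘ₗ LinearMap.mulLeft ℂ (star a) ∘ₗ
    LinearMap.mulRight ℂ a
  nonneg' x := by
    have h := φ.nonneg (x * a)
    have h' := φ.nonneg a
    simp only [LinearMap.smul_apply, LinearMap.comp_apply, LinearMap.mulRight_apply,
      LinearMap.mulLeft_apply, smul_eq_mul]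
    rw [star_mul, mul_assoc] at h
    rw [mul_assoc]
    rw [φ.map_star_mul_self a] at h' ⊢
    refine mul_nonneg ?_ h
    exact_mod_cast inv_nonneg.2 (by exact_mod_cast h')
  map_one' := by
    simp only [LinearMap.smul_apply, LinearMap.comp_apply, LinearMap.mulRight_apply,
      LinearMap.mulLeft_apply, smul_eq_mul, one_mul]
    exact inv_mul_cancel₀ ha

theorem conj_apply (φ : CStarState A) (a : A) (ha : φ (star a * a) ≠ 0) (x : A) :
    φ.conj a ha x = (φ (star a * a))⁻¹ * φ (star a * (x * a)) := rfl

end CStarState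

end States

/-! ### Product states: slices, faithfulness, trace property -/

section Faithful

universe u v

variable {I : Type u} {A : I → Type v} [∀ i, CStarAlgebra (A i)]

open MinTensor

theorem productState_tmul_eq_prod (s : ∀ i, CStarState (A i)) (c : ElemTensor A) (F : Finset I)
    (hc : ∀ i, i ∉ F → c.1 i = 1) : productState s (tmul c) = ∏ i ∈ F, s i (c.1 i) := by
  rw [productState_tmul]
  refine finprod_eq_prod_of_mulSupport_subset _ fun i hi => ?_
  by_contra h
  exact hi (by simp [hc i h])

open Classical in
theorem productState_update_tmul (s : ∀ i, CStarState (A i)) (j : I) (c : ElemTensor A) :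
    ∃ z : ℂ, ∀ t : CStarState (A j),
      productState (Function.update s j t) (tmul c) = z * t (c.1 j) := by
  obtain ⟨F, hF⟩ := ElemTensor.exists_finset c
  refine ⟨∏ i ∈ (insert j F).erase j, s i (c.1 i), fun t => ?_⟩
  rw [productState_tmul_eq_prod _ c (insert j F) (fun i hi => hF i (by simp_all)),
    ← Finset.prod_erase_mul _ _ (Finset.mem_insert_self j F), Function.update_self]
  congr 1
  refine Finset.prod_congr rfl fun i hi => ?_
  rw [Function.update_of_ne (Finset.ne_of_mem_erase hi)]

open Classical in
/-- The slice of `x` along the states `sᵢ`, `i ≠ j`. -/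
theorem exists_slice (s : ∀ i, CStarState (A i)) (j : I) (x : MinTensor A) :
    ∃ e : A j, ∀ t : CStarState (A j), t e = productState (Function.update s j t) x := by
  induction x using MinTensor.induction_on with
  | ht c =>
    obtain ⟨z, hz⟩ := productState_update_tmul s j c
    exact ⟨z • c.1 j, fun t => by rw [hz, map_smul, smul_eq_mul]⟩
  | ha x y hx hy =>
    obtain ⟨e, he⟩ := hx
    obtain ⟨f, hf⟩ := hy
    exact ⟨e + f, fun t => by rw [map_add, map_add, he, hf]⟩
  | hs r x hx =>
    obtain ⟨e, he⟩ := hx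
    exact ⟨r • e, fun t => by rw [map_smul, map_smul, he]⟩
  | hc =>
    refine isClosed_of_closure_subset fun x hx => ?_
    obtain ⟨u, hu, hux⟩ := mem_closure_iff_seq_limit.1 hx
    choose e he using hu
    -- Slices of a convergent sequence form a Cauchy sequence: each state of `A j` takes on their
    -- difference the value of a product state, and states control the norm up to a factor `2`.
    have hd : ∀ m n, ‖e m - e n‖ ≤ 2 * ‖u m - u n‖ := fun m n =>
      CStarState.norm_le_two_mul (norm_nonneg _) fun t => by
        rw [map_sub, he, he, ← map_sub]
        exact CStarState.norm_apply_le _ _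
    have hC : CauchySeq e := by
      refine Metric.cauchySeq_iff.2 fun ε hε => ?_
      obtain ⟨N, hN⟩ := Metric.cauchySeq_iff.1 hux.cauchySeq (ε / 2) (by positivity)
      refine ⟨N, fun m hm n hn => ?_⟩
      have := hN m hm n hn
      rw [dist_eq_norm] at this ⊢
      linarith [hd m n]
    obtain ⟨e₀, he₀⟩ := cauchySeq_tendsto_of_complete hC
    refine ⟨e₀, fun t => tendsto_nhds_unique ((t.continuous.tendsto _).comp he₀) ?_⟩
    refine (((productState (Function.update s j t)).continuous.tendsto _).comp hux).congr fun n => ?_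
    exact (he n t).symm

open Classical in
-- The slice of `x* x` at `j` is nonnegative under every state, hence positive. The faithful state
-- `s j` vanishes on it, so the slice is zero and every other state vanishes on it too.
theorem productState_update_eq_zero (s : ∀ i, CStarState (A i)) (j : I) (hs : (s j).IsFaithful)
    (x : MinTensor A) (hx : productState s (star x * x) = 0) (t : CStarState (A j)) :
    productState (Function.update s j t) (star x * x) = 0 := by
  let _ := CStarAlgebra.spectralOrder (A j)
  have _ := CStarAlgebra.spectralOrderedRing (A j)
  obtain ⟨e, he⟩ := exists_slice s j (star x * x)
  have h0 : 0 ≤ e := CStarState.nonneg_of_forall fun φ => by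
    rw [he]; exact CStarState.nonneg _ x
  obtain ⟨b, rfl⟩ := CStarAlgebra.nonneg_iff_eq_star_mul_self.1 h0
  have hb : b = 0 := hs b (by rw [he, Function.update_eq_self, hx])
  rw [← he, hb, mul_zero, map_zero]

/-- For an elementary tensor the value depends on finitely many of the states exactly. Contractivity
of states carries the approximate version to limits, uniformly in the families. -/
theorem exists_finset_norm_productState_sub_le (x : MinTensor A) : ∀ ε : ℝ, 0 < ε →
    ∃ F : Finset I, ∀ s t : ∀ i, CStarState (A i), (∀ i ∈ F, s i = t i) →
      ‖productState s x - productState t x‖ ≤ ε := by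
  classical
  induction x using MinTensor.induction_on with
  | ht c =>
    obtain ⟨F, hF⟩ := ElemTensor.exists_finset c
    refine fun ε hε => ⟨F, fun s t h => ?_⟩
    rw [productState_tmul_eq_prod s c F hF, productState_tmul_eq_prod t c F hF,
      Finset.prod_congr rfl fun i hi => by rw [h i hi], sub_self, norm_zero]
    exact hε.le
  | ha x y hx hy =>
    intro ε hε
    obtain ⟨F, hF⟩ := hx (ε / 2) (by positivity)
    obtain ⟨G, hG⟩ := hy (ε / 2) (by positivity)
    refine ⟨F ∪ G, fun s t h => ?_⟩
    rw [map_add, map_add, add_sub_add_comm]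
    refine (norm_add_le _ _).trans ?_
    linarith [hF s t fun i hi => h i (Finset.mem_union_left _ hi),
      hG s t fun i hi => h i (Finset.mem_union_right _ hi)]
  | hs r x hx =>
    intro ε hε
    obtain ⟨F, hF⟩ := hx (ε / (‖r‖ + 1)) (by positivity)
    refine ⟨F, fun s t h => ?_⟩
    rw [map_smul, map_smul, ← smul_sub, norm_smul]
    have h1 := hF s t h
    rw [le_div_iff₀ (by positivity)] at h1
    nlinarith [norm_nonneg (productState s x - productState t x)]
  | hc =>
    refine isClosed_of_closure_subset fun x hx ε hε => ?_
    obtain ⟨y, hy, hxy⟩ := Metric.mem_closure_iff.1 hx (ε / 3) (by positivity)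
    obtain ⟨F, hF⟩ := hy (ε / 3) (by positivity)
    refine ⟨F, fun s t h => ?_⟩
    rw [dist_eq_norm] at hxy
    have e : productState s x - productState t x = productState s (x - y)
        + (productState s y - productState t y) - productState t (x - y) := by
      rw [map_sub, map_sub]; ring
    rw [e]
    refine (norm_sub_le _ _).trans ((add_le_add_left (norm_add_le _ _) _).trans ?_)
    linarith [hF s t h, (productState s).norm_apply_le (x - y),
      (productState t).norm_apply_le (x - y)]

/-- The states `ψ i` are exchanged for `t i` one at a time. Coordinates not yet exchanged still
carry faithful states, and the infinitely many remaining ones contribute at most `ε`. -/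
theorem productState_eq_zero_of_isFaithful (ψ : ∀ i, CStarState (A i))
    (hψ : ∀ i, (ψ i).IsFaithful) (x : MinTensor A) (hx : productState ψ (star x * x) = 0)
    (t : ∀ i, CStarState (A i)) : productState t (star x * x) = 0 := by
  classical
  have h : ∀ F : Finset I, productState (F.piecewise t ψ) (star x * x) = 0 := fun F => by
    induction F using Finset.induction_on with
    | empty => rwa [Finset.piecewise_empty]
    | insert j F hj ih =>
      rw [Finset.piecewise_insert]
      refine productState_update_eq_zero _ j ?_ x ih (t j)
      rw [Finset.piecewise_eq_of_notMem _ _ _ hj]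
      exact hψ j
  refine norm_le_zero_iff.1 (le_of_forall_pos_le_add fun ε hε => ?_)
  obtain ⟨F, hF⟩ := exists_finset_norm_productState_sub_le (star x * x) ε hε
  have := hF t (F.piecewise t ψ) fun i hi => (Finset.piecewise_eq_of_mem _ _ _ hi).symm
  rwa [h, sub_zero, ← zero_add ε] at this

theorem MinTensor.norm_rep_le (s : ∀ i, CStarState (A i)) (x : MinTensor A) : ‖rep s x‖ ≤ ‖x‖ :=
  NonUnitalStarAlgHom.norm_apply_le (rep s) x

theorem MinTensor.continuous_rep (s : ∀ i, CStarState (A i)) : Continuous (rep s) :=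
  AddMonoidHomClass.continuous_of_bound (rep s) 1 fun x => by
    rw [one_mul]; exact norm_rep_le s x

/-- The vector state at `⊗ aᵢ` is a multiple of the product of the states `x ↦ sᵢ (aᵢ* x aᵢ) / sᵢ
(aᵢ* aᵢ)`. If some denominator vanishes, the vector itself is zero. -/
theorem exists_inner_rep_preVec (s : ∀ i, CStarState (A i)) (a : ElemTensor A) :
    ∃ (z : ℂ) (t : ∀ i, CStarState (A i)), ∀ y : MinTensor A,
      inner ℂ ((preVec s a : PreProdGNS s) : ProdGNS s) (rep s y (preVec s a : PreProdGNS s))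
        = z * productState t y := by
  classical
  obtain ⟨F, hF⟩ := ElemTensor.exists_finset a
  by_cases h : ∀ i, s i (star (a.1 i) * a.1 i) ≠ 0
  · refine ⟨∏ i ∈ F, s i (star (a.1 i) * a.1 i), fun i => (s i).conj (a.1 i) (h i), fun y => ?_⟩
    induction y using MinTensor.induction_on with
    | ht c =>
      obtain ⟨G, hG⟩ := ElemTensor.exists_finset c
      rw [rep_tmul, inner_elemOp, prodKernel_eq_prod s a (c * a) (F ∪ G)
          (fun i hi => hF i (by simp_all))
          (fun i hi => by simp [hF i (by simp_all), hG i (by simp_all)]),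
        productState_tmul_eq_prod _ c (F ∪ G) (fun i hi => hG i (by simp_all)),
        Finset.prod_subset (Finset.subset_union_left (s₁ := F) (s₂ := G))
          (f := fun i => s i (star (a.1 i) * a.1 i)) fun i _ hi => by simp [hF i hi],
        ← Finset.prod_mul_distrib]
      refine Finset.prod_congr rfl fun i _ => ?_
      rw [CStarState.conj_apply, mul_inv_cancel_left₀ (h i)]
      rfl
    | ha x y hx hy =>
      rw [map_add (rep s), add_apply, inner_add_right, hx, hy, map_add, mul_add]
    | hs r x hx =>
      rw [map_smul (rep s), smul_apply, inner_smul_right, hx, map_smul, smul_eq_mul]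
      ring
    | hc =>
      refine isClosed_eq ?_ (continuous_const.mul (productState _).continuous)
      exact continuous_const.inner ((MinTensor.continuous_rep s).clm_apply continuous_const)
  · push Not at h
    obtain ⟨i, hi⟩ := h
    refine ⟨0, s, fun y => ?_⟩
    have h0 : ((preVec s a : PreProdGNS s) : ProdGNS s) = 0 := by
      rw [← inner_self_eq_zero (𝕜 := ℂ), UniformSpace.Completion.inner_coe, inner_preVec,
        prodKernel_eq_prod s a a (insert i F) (fun k hk => hF k (by simp_all))
          (fun k hk => hF k (by simp_all))]
      exact Finset.prod_eq_zero (Finset.mem_insert_self i F) hi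
    rw [h0, inner_zero_left, zero_mul]

/-- `‖x v‖²` is the value of the vector state of `v` at `x* x`; it vanishes for `v` in a total set
in every representation. -/
theorem eq_zero_of_forall_productState (x : MinTensor A)
    (h : ∀ t : ∀ i, CStarState (A i), productState t (star x * x) = 0) : x = 0 := by
  refine MinTensor.ext_rep fun s => ProdGNS.op_ext_vec s fun a => ?_
  obtain ⟨z, t, hz⟩ := exists_inner_rep_preVec s a
  have h1 := hz (star x * x)
  rw [h, mul_zero, map_mul (rep s), map_star (rep s), ContinuousLinearMap.star_eq_adjoint,
    mul_apply_eq_comp, ContinuousLinearMap.adjoint_inner_right, inner_self_eq_zero] at h1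
  rw [h1, map_zero (rep s), zero_apply]

theorem productState_isFaithful (ψ : ∀ i, CStarState (A i)) (hψ : ∀ i, (ψ i).IsFaithful) :
    (productState ψ).IsFaithful := fun x hx =>
  eq_zero_of_forall_productState x (productState_eq_zero_of_isFaithful ψ hψ x hx)

theorem productState_isTracial (τ : ∀ i, CStarState (A i)) (hτ : ∀ i, (τ i).IsTracial) :
    (productState τ).IsTracial := fun x y => by
  have hc := (productState τ).continuous
  induction x using MinTensor.induction_on with
  | ht c =>
    induction y using MinTensor.induction_on with
    | ht d =>
      rw [← tmul_mul, ← tmul_mul, productState_tmul, productState_tmul]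
      exact finprod_congr fun i => hτ i _ _
    | ha x y hx hy => rw [mul_add, add_mul, map_add, map_add, hx, hy]
    | hs r x hx => rw [mul_smul_comm, smul_mul_assoc, map_smul, map_smul, hx]
    | hc => exact isClosed_eq (by fun_prop) (by fun_prop)
  | ha x y hx hy => rw [mul_add, add_mul, map_add, map_add, hx, hy]
  | hs r x hx => rw [mul_smul_comm, smul_mul_assoc, map_smul, map_smul, hx]
  | hc => exact isClosed_eq (by fun_prop) (by fun_prop)

end Faithful

/-! ### Averaging by unitaries of a subalgebra -/

section Averaging

variable {C : Type*} [CStarAlgebra C] {B : StarSubalgebra ℂ C}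

/-- Linear maps that leave invariant every convex set that is invariant under conjugation by the
unitaries of `B`, such as the convex combinations of these conjugations. -/
def IsAveraging (B : StarSubalgebra ℂ C) (F : C →ₗ[ℂ] C) : Prop :=
  ∀ K : Set C, Convex ℝ K → (∀ u ∈ unitary C, u ∈ B → ∀ x ∈ K, star u * x * u ∈ K) →
    ∀ x ∈ K, F x ∈ K

namespace IsAveraging

theorem id : IsAveraging B LinearMap.id := fun _ _ _ _ hx => hx

theorem comp {F G : C →ₗ[ℂ] C} (hF : IsAveraging B F) (hG : IsAveraging B G) :
    IsAveraging B (F ∘ₗ G) := fun K hK hu x hx => hF K hK hu _ (hG K hK hu x hx)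

theorem conj {u : C} (hu : u ∈ unitary C) (huB : u ∈ B) :
    IsAveraging B (LinearMap.mulRight ℂ u ∘ₗ LinearMap.mulLeft ℂ (star u)) :=
  fun _ _ h x hx => h u hu huB x hx

theorem combo {F G : C →ₗ[ℂ] C} (hF : IsAveraging B F) (hG : IsAveraging B G) {a b : ℝ}
    (ha : 0 ≤ a) (hb : 0 ≤ b) (hab : a + b = 1) : IsAveraging B (a • F + b • G) :=
  fun K hK hu x hx => hK (hF K hK hu x hx) (hG K hK hu x hx) ha hb hab

/-- Properties of averaging maps are read off from suitable invariant convex sets: here a closed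
ball, below a singleton, a level set of a trace, and the convex hull of an orbit. -/
theorem norm_apply_le {F : C →ₗ[ℂ] C} (hF : IsAveraging B F) (x : C) : ‖F x‖ ≤ ‖x‖ := by
  have := hF (Metric.closedBall 0 ‖x‖) (convex_closedBall _ _) (fun u hu _ y hy => by
    rw [mem_closedBall_zero_iff] at hy ⊢
    rwa [CStarRing.norm_mul_mem_unitary _ hu,
      CStarRing.norm_mem_unitary_mul _ (Unitary.star_mem hu)]) x (by simp)
  simpa using this

theorem map_one {F : C →ₗ[ℂ] C} (hF : IsAveraging B F) : F 1 = 1 :=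
  hF {1} (convex_singleton 1) (fun u hu _ y hy => by
    rw [Set.mem_singleton_iff] at hy ⊢
    rw [hy, mul_one, Unitary.star_mul_self_of_mem hu]) 1 rfl

theorem state_apply {φ : CStarState C} (hφ : φ.IsTracial) {F : C →ₗ[ℂ] C}
    (hF : IsAveraging B F) (x : C) : φ (F x) = φ x := by
  refine hF {y | φ y = φ x} ?_ ?_ x rfl
  · intro y hy z hz a b _ _ hab
    rw [Set.mem_ofPred_eq] at hy hz ⊢
    rw [map_add, ← Complex.coe_smul, ← Complex.coe_smul, map_smul, map_smul, hy, hz, ← add_smul,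
      ← Complex.ofReal_add, hab, Complex.ofReal_one, one_smul]
  · intro u hu _ y hy
    rw [Set.mem_ofPred_eq, hφ, ← mul_assoc, Unitary.mul_star_self_of_mem hu, one_mul]
    exact hy

theorem apply_mem_convexHull {F : C →ₗ[ℂ] C} (hF : IsAveraging B F) (x : C) :
    F x ∈ convexHull ℝ {y | ∃ u ∈ unitary C, u ∈ B ∧ y = star u * x * u} := by
  refine hF _ (convex_convexHull ℝ _) (fun u hu huB y hy => ?_) x
    (subset_convexHull ℝ _ ⟨1, one_mem _, one_mem _, by simp⟩)
  have := (LinearMap.mulRight ℝ u ∘ₗ LinearMap.mulLeft ℝ (star u)).image_convexHull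
    {y | ∃ u ∈ unitary C, u ∈ B ∧ y = star u * x * u}
  refine convexHull_mono ?_ (this ▸ Set.mem_image_of_mem _ hy)
  rintro _ ⟨_, ⟨v, hv, hvB, rfl⟩, rfl⟩
  exact ⟨v * u, mul_mem hv hu, mul_mem hvB huB, by simp [mul_assoc]⟩

end IsAveraging

theorem state_eq_of_mem_dixmierSet {φ : CStarState C} (hφ : φ.IsTracial) {x y : C}
    (hy : y ∈ dixmierSet B x) : φ y = φ x := by
  refine closure_minimal (convexHull_min ?_ ?_) (isClosed_eq φ.continuous continuous_const) hy
  · rintro _ ⟨u, hu, huB, rfl⟩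
    exact (IsAveraging.conj hu huB).state_apply hφ x
  · intro y hy z hz a b _ _ hab
    rw [Set.mem_ofPred_eq] at hy hz ⊢
    rw [map_add, ← Complex.coe_smul, ← Complex.coe_smul, map_smul, map_smul, hy, hz, ← add_smul,
      ← Complex.ofReal_add, hab, Complex.ofReal_one, one_smul]

end Averaging

/-! ### The Dixmier property of the tensor product -/

section DixmierTensor

universe u v

variable {I : Type u} {A : I → Type v} [∀ i, CStarAlgebra (A i)]
  {B : ∀ i, StarSubalgebra ℂ (A i)}

open MinTensor

theorem MinTensor.incl_mul_tmul_update (c : ElemTensor A) (j : I) (x a : A j) :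
    incl j x * tmul (ElemTensor.update c j a) = tmul (ElemTensor.update c j (x * a)) := by
  rw [incl_apply, ← tmul_mul, ElemTensor.update_mul_update, one_mul]

theorem MinTensor.tmul_update_mul_incl (c : ElemTensor A) (j : I) (x a : A j) :
    tmul (ElemTensor.update c j a) * incl j x = tmul (ElemTensor.update c j (a * x)) := by
  rw [incl_apply, ← tmul_mul, ElemTensor.update_mul_update, mul_one]

theorem MinTensor.tmul_mem_subTensor {c : ElemTensor A} (hc : ∀ i, c.1 i ∈ B i) :
    tmul c ∈ subTensor B :=
  StarSubalgebra.le_topologicalClosure _ (StarAlgebra.subset_adjoin ℂ _ ⟨c, hc, rfl⟩)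

theorem ElemTensor.update_mem {c : ElemTensor A} (hc : ∀ i, c.1 i ∈ B i) {j : I} {a : A j}
    (ha : a ∈ B j) (i : I) : (ElemTensor.update c j a).1 i ∈ B i := by
  by_cases h : i = j
  · subst h; simpa using ha
  · rw [ElemTensor.update_of_ne _ h]; exact hc i

theorem MinTensor.incl_mem_subTensor {j : I} {b : A j} (hb : b ∈ B j) :
    incl j b ∈ subTensor B :=
  tmul_mem_subTensor fun i => ElemTensor.update_mem (fun i => one_mem (B i)) hb i

/-- The linear map `F` acts on elementary tensors as `f` on the coordinate `j`. -/
def ActsOnCoord (j : I) (f : A j →ₗ[ℂ] A j) (F : MinTensor A →ₗ[ℂ] MinTensor A) : Prop :=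
  ∀ c a, F (tmul (ElemTensor.update c j a)) = tmul (ElemTensor.update c j (f a))

theorem ActsOnCoord.comp {j : I} {f g : A j →ₗ[ℂ] A j} {F G : MinTensor A →ₗ[ℂ] MinTensor A}
    (hF : ActsOnCoord j f F) (hG : ActsOnCoord j g G) : ActsOnCoord j (f ∘ₗ g) (F ∘ₗ G) :=
  fun c a => by rw [LinearMap.comp_apply, hG, hF, LinearMap.comp_apply]

theorem ActsOnCoord.apply_tmul {j : I} {f : A j →ₗ[ℂ] A j} {F : MinTensor A →ₗ[ℂ] MinTensor A}
    (hF : ActsOnCoord j f F) (c : ElemTensor A) :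
    F (tmul c) = tmul (ElemTensor.update c j (f (c.1 j))) := by
  rw [← hF, ElemTensor.update_eq_self]

/-- Points reached by a pair of an averaging map on `A j` and its lift to the tensor product form a
convex set containing the orbit of `a`: conjugation by `u` lifts to conjugation by `incl j u`. -/
theorem exists_averaging_of_mem_convexHull {j : I} {a y : A j}
    (hy : y ∈ convexHull ℝ {x | ∃ u ∈ unitary (A j), u ∈ B j ∧ x = star u * a * u}) :
    ∃ f F, IsAveraging (B j) f ∧ IsAveraging (subTensor B) F ∧ ActsOnCoord j f F ∧ f a = y := by
  refine convexHull_min (t := {y | ∃ f F, IsAveraging (B j) f ∧ IsAveraging (subTensor B) F ∧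
    ActsOnCoord j f F ∧ f a = y}) ?_ ?_ hy
  · rintro _ ⟨u, hu, huB, rfl⟩
    refine ⟨_, _, .conj hu huB, .conj (u := incl j u) ?_ (incl_mem_subTensor huB), ?_, rfl⟩
    · exact Unitary.map_mem (incl j) hu
    · intro c b
      simp only [LinearMap.comp_apply, LinearMap.mulLeft_apply, LinearMap.mulRight_apply]
      rw [← map_star (incl j), incl_mul_tmul_update, tmul_update_mul_incl]
  · rintro _ ⟨f, F, hf, hF, h, rfl⟩ _ ⟨g, G, hg, hG, h', rfl⟩ r t hr ht hrt
    refine ⟨_, _, hf.combo hg hr ht hrt, hF.combo hG hr ht hrt, fun c b => ?_, rfl⟩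
    simp only [LinearMap.add_apply, LinearMap.smul_apply]
    rw [tmul_update_add, h, h', ← Complex.coe_smul, ← Complex.coe_smul, ← Complex.coe_smul,
      ← Complex.coe_smul, tmul_update_smul, tmul_update_smul]

variable {τ : ∀ i, CStarState (A i)}

theorem exists_averaging_norm_lt {j : I} (hτ : (τ j).IsTracial) (hB : HasRelativeDixmier (B j))
    (a : A j) {ε : ℝ} (hε : 0 < ε) :
    ∃ f F, IsAveraging (B j) f ∧ IsAveraging (subTensor B) F ∧ ActsOnCoord j f F ∧
      ‖f a - τ j a • 1‖ < ε := by
  obtain ⟨_, hz, z, rfl⟩ := hB a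
  obtain ⟨y, hy, hyz⟩ := Metric.mem_closure_iff.1 hz ε hε
  obtain ⟨f, F, hf, hF, h, rfl⟩ := exists_averaging_of_mem_convexHull hy
  refine ⟨f, F, hf, hF, h, ?_⟩
  have := state_eq_of_mem_dixmierSet hτ hz
  rw [CStarState.map_algebraMap] at this
  rwa [← this, ← Algebra.algebraMap_eq_smul_one, ← dist_eq_norm, dist_comm]

/-- Elements are treated in succession. A later map `g` is unital and contractive, so it keeps the
earlier elements near their scalars, and `f` preserves the trace, so the scalar for the new element
is still `τ j a`. -/
theorem exists_averaging_finset {j : I} (hτ : (τ j).IsTracial) (hB : HasRelativeDixmier (B j))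
    (T : Finset (A j)) {ε : ℝ} (hε : 0 < ε) :
    ∃ f F, IsAveraging (B j) f ∧ IsAveraging (subTensor B) F ∧ ActsOnCoord j f F ∧
      ∀ a ∈ T, ‖f a - τ j a • 1‖ < ε := by
  classical
  induction T using Finset.induction_on with
  | empty => exact ⟨_, _, .id, .id, fun _ _ => rfl, by simp⟩
  | insert a T ha ih =>
    obtain ⟨f, F, hf, hF, h, hT⟩ := ih
    obtain ⟨g, G, hg, hG, h', ha⟩ := exists_averaging_norm_lt hτ hB (f a) hε
    refine ⟨_, _, hg.comp hf, hG.comp hF, h'.comp h, fun b hb => ?_⟩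
    rw [LinearMap.comp_apply]
    rcases Finset.mem_insert.1 hb with rfl | hb
    · rwa [hf.state_apply hτ] at ha
    · have e : g (f b) - τ j b • 1 = g (f b - τ j b • 1) := by
        rw [map_sub, map_smul, hg.map_one]
      rw [e]
      exact (hg.norm_apply_le _).trans_lt (hT b hb)

open Classical in
/-- Replacement of the coordinates in `S` by `1`. -/
def ElemTensor.eraseOn (S : Finset I) (c : ElemTensor A) : ElemTensor A :=
  ⟨S.piecewise 1 c.1, c.2.subset fun i hi h => hi (by
    by_cases hS : i ∈ S
    · exact Finset.piecewise_eq_of_mem _ _ _ hS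
    · exact (Finset.piecewise_eq_of_notMem _ _ _ hS).trans h)⟩

theorem ElemTensor.eraseOn_apply_of_mem {S : Finset I} {i : I} (hi : i ∈ S) (c : ElemTensor A) :
    (ElemTensor.eraseOn S c).1 i = 1 := by
  classical exact Finset.piecewise_eq_of_mem _ _ _ hi

theorem ElemTensor.eraseOn_apply_of_notMem {S : Finset I} {i : I} (hi : i ∉ S)
    (c : ElemTensor A) : (ElemTensor.eraseOn S c).1 i = c.1 i := by
  classical exact Finset.piecewise_eq_of_notMem _ _ _ hi

open Classical in
theorem ElemTensor.update_eraseOn (S : Finset I) (j : I) (c : ElemTensor A) :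
    ElemTensor.update (ElemTensor.eraseOn S c) j 1 = ElemTensor.eraseOn (insert j S) c :=
  Subtype.ext (Finset.piecewise_insert _ _ _ _).symm

theorem ElemTensor.eraseOn_eq_one {S : Finset I} {c : ElemTensor A}
    (h : ∀ i, i ∉ S → c.1 i = 1) : ElemTensor.eraseOn S c = 1 := by
  refine ElemTensor.ext' fun i => ?_
  by_cases hi : i ∈ S
  · exact ElemTensor.eraseOn_apply_of_mem hi c
  · rw [ElemTensor.eraseOn_apply_of_notMem hi, h i hi]; rfl

/-- Coordinates in `S` are averaged to scalars one after another. A single map serves all of `T`,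
because a general element is approximated by linear combinations. -/
theorem exists_averaging_eraseOn (hτ : ∀ i, (τ i).IsTracial)
    (hB : ∀ i, HasRelativeDixmier (B i)) (T : Finset (ElemTensor A)) (S : Finset I) :
    ∀ ε : ℝ, 0 < ε → ∃ F, IsAveraging (subTensor B) F ∧ ∀ c ∈ T,
      ‖F (tmul c) - (∏ i ∈ S, τ i (c.1 i)) • tmul (ElemTensor.eraseOn S c)‖ < ε := by
  classical
  induction S using Finset.induction_on with
  | empty =>
    refine fun ε hε => ⟨_, .id, fun c _ => ?_⟩
    have : ElemTensor.eraseOn ∅ c = c :=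
      ElemTensor.ext' fun i => ElemTensor.eraseOn_apply_of_notMem (by simp) c
    rw [this]
    simpa using hε
  | insert j S hj ih =>
    intro ε hε
    obtain ⟨F, hF, hT⟩ := ih (ε / 2) (by positivity)
    -- `K c` bounds the factor by which the error at coordinate `j` is multiplied. The sum over `T`,
    -- plus `1`, gives one tolerance for all `c` with a positive denominator.
    set K : ElemTensor A → ℝ := fun c => ‖∏ i ∈ S, τ i (c.1 i)‖ *
      ‖tmul (ElemTensor.eraseOn (insert j S) c)‖ with hK
    have hK0 : ∀ c, 0 ≤ K c := fun c => by positivity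
    have hs : 0 ≤ ∑ c ∈ T, K c := Finset.sum_nonneg fun c _ => hK0 c
    obtain ⟨g, G, -, hG, h, hg⟩ := exists_averaging_finset (hτ j) (hB j)
      (T.image fun c => c.1 j) (ε := ε / 2 / (∑ c ∈ T, K c + 1)) (by positivity)
    refine ⟨_, hG.comp hF, fun c hc => ?_⟩
    have h1 := hT c hc
    have h2 := hg (c.1 j) (Finset.mem_image_of_mem _ hc)
    set l := ∏ i ∈ S, τ i (c.1 i) with hl
    -- The old error, not enlarged by the contraction `G`, plus the new error confined to coordinate
    -- `j`.
    have e : G (F (tmul c)) - (∏ i ∈ insert j S, τ i (c.1 i)) •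
        tmul (ElemTensor.eraseOn (insert j S) c) =
        G (F (tmul c) - l • tmul (ElemTensor.eraseOn S c)) +
        l • (tmul (ElemTensor.eraseOn (insert j S) c) * incl j (g (c.1 j) - τ j (c.1 j) • 1)) := by
      rw [map_sub, map_smul, h.apply_tmul, tmul_update, ElemTensor.update_eraseOn,
        ElemTensor.eraseOn_apply_of_notMem hj, Finset.prod_insert hj, ← hl, map_sub (incl j),
        map_smul (incl j), _root_.map_one (incl j), mul_sub, mul_smul_comm, mul_one, smul_sub,
        smul_smul, mul_comm l]
      abel
    rw [LinearMap.comp_apply, e]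
    refine (norm_add_le _ _).trans_lt ?_
    have h3 : ‖l • (tmul (ElemTensor.eraseOn (insert j S) c) *
        incl j (g (c.1 j) - τ j (c.1 j) • 1))‖ ≤ ε / 2 := by
      rw [norm_smul]
      refine (mul_le_mul_of_nonneg_left ((norm_mul_le _ _).trans
        (mul_le_mul_of_nonneg_left ((norm_incl_le _ _).trans h2.le) (norm_nonneg _)))
        (norm_nonneg _)).trans ?_
      rw [← mul_assoc, mul_div_assoc', div_le_iff₀ (by positivity), mul_comm]
      refine mul_le_mul_of_nonneg_left ?_ (by positivity)
      have := Finset.single_le_sum (fun c _ => hK0 c) hc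
      change K c ≤ _
      linarith
    linarith [hG.norm_apply_le (F (tmul c) - l • tmul (ElemTensor.eraseOn S c))]

theorem exists_averaging_tmul (hτ : ∀ i, (τ i).IsTracial)
    (hB : ∀ i, HasRelativeDixmier (B i)) (T : Finset (ElemTensor A)) {ε : ℝ} (hε : 0 < ε) :
    ∃ F, IsAveraging (subTensor B) F ∧ ∀ c ∈ T,
      ‖F (tmul c) - productState τ (tmul c) • 1‖ < ε := by
  obtain ⟨S, hS⟩ := exists_finset_support T
  obtain ⟨F, hF, h⟩ := exists_averaging_eraseOn hτ hB T S ε hε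
  refine ⟨F, hF, fun c hc => ?_⟩
  have := h c hc
  rwa [ElemTensor.eraseOn_eq_one (hS c hc), tmul_one,
    ← productState_tmul_eq_prod τ c S (hS c hc)] at this

theorem exists_averaging (hτ : ∀ i, (τ i).IsTracial)
    (hB : ∀ i, HasRelativeDixmier (B i)) (x : MinTensor A) {ε : ℝ} (hε : 0 < ε) :
    ∃ F, IsAveraging (subTensor B) F ∧ ‖F x - productState τ x • 1‖ < ε := by
  obtain ⟨y, hy, hxy⟩ := Metric.mem_closure_iff.1 (dense_span_tmul x) (ε / 3) (by positivity)
  obtain ⟨w, rfl⟩ := Finsupp.mem_span_range_iff_exists_finsupp.1 hy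
  set y := w.sum fun c z => z • tmul c with hy'
  have hs : 0 ≤ ∑ c ∈ w.support, ‖w c‖ := Finset.sum_nonneg fun c _ => norm_nonneg _
  obtain ⟨F, hF, h⟩ := exists_averaging_tmul hτ hB w.support
    (ε := ε / 3 / (∑ c ∈ w.support, ‖w c‖ + 1)) (by positivity)
  refine ⟨F, hF, ?_⟩
  have h1 : ‖F y - productState τ y • 1‖ ≤ ε / 3 := by
    have e : F y - productState τ y • 1 = ∑ c ∈ w.support,
        w c • (F (tmul c) - productState τ (tmul c) • 1) := by
      simp only [hy', Finsupp.sum, map_sum, map_smul, Finset.sum_smul, smul_sub,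
        Finset.sum_sub_distrib, smul_assoc]
    rw [e]
    refine (norm_sum_le_of_le _ fun c hc => (norm_smul_le _ _).trans
      (mul_le_mul_of_nonneg_left (h c hc).le (norm_nonneg _))).trans ?_
    rw [← Finset.sum_mul, mul_div_assoc', div_le_iff₀ (by positivity), mul_comm]
    exact mul_le_mul_of_nonneg_left (by linarith) (by positivity)
  have e : F x - productState τ x • 1 = F (x - y) + (F y - productState τ y • 1)
      - productState τ (x - y) • 1 := by
    rw [map_sub, map_sub, sub_smul]; abel
  rw [dist_eq_norm] at hxy
  have hn : Nontrivial (MinTensor A) := by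
    by_contra hn
    rw [not_nontrivial_iff_subsingleton] at hn
    have := (productState τ).map_one
    rw [Subsingleton.elim (1 : MinTensor A) 0, map_zero] at this
    exact zero_ne_one this
  have h2 : ‖productState τ (x - y) • (1 : MinTensor A)‖ ≤ ‖x - y‖ := by
    rw [norm_smul, CStarRing.norm_one, mul_one]
    exact CStarState.norm_apply_le _ _
  rw [e]
  refine (norm_sub_le _ _).trans_lt ((add_le_add_left (norm_add_le _ _) _).trans_lt ?_)
  linarith [hF.norm_apply_le (x - y)]

theorem productState_smul_one_mem_dixmierSet (hτ : ∀ i, (τ i).IsTracial)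
    (hB : ∀ i, HasRelativeDixmier (B i)) (x : MinTensor A) :
    algebraMap ℂ (MinTensor A) (productState τ x) ∈ dixmierSet (subTensor B) x := by
  refine Metric.mem_closure_iff.2 fun ε hε => ?_
  obtain ⟨F, hF, h⟩ := exists_averaging hτ hB x hε
  refine ⟨F x, hF.apply_mem_convexHull x, ?_⟩
  rwa [Algebra.algebraMap_eq_smul_one, dist_comm, dist_eq_norm]

theorem hasRelativeDixmier_subTensor (hτ : ∀ i, (τ i).IsTracial)
    (hB : ∀ i, HasRelativeDixmier (B i)) : HasRelativeDixmier (subTensor B) := fun x =>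
  ⟨_, productState_smul_one_mem_dixmierSet hτ hB x, _, rfl⟩

theorem dixmierSet_subTensor_inter (hτ : ∀ i, (τ i).IsTracial)
    (hB : ∀ i, HasRelativeDixmier (B i)) (x : MinTensor A) :
    dixmierSet (subTensor B) x ∩ Set.range (algebraMap ℂ (MinTensor A)) =
      {algebraMap ℂ (MinTensor A) (productState τ x)} := by
  refine Set.Subset.antisymm ?_ (Set.singleton_subset_iff.2
    ⟨productState_smul_one_mem_dixmierSet hτ hB x, _, rfl⟩)
  rintro _ ⟨hz, z, rfl⟩
  rw [← state_eq_of_mem_dixmierSet (productState_isTracial τ hτ) hz, CStarState.map_algebraMap]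
  rfl

end DixmierTensor

/-! ### A criterion for C*-irreducibility -/

section Irreducible

variable {C : Type*} [CStarAlgebra C]

theorem CStarState.nontrivial (φ : CStarState C) : Nontrivial C := by
  by_contra hn
  rw [not_nontrivial_iff_subsingleton] at hn
  have := φ.map_one
  rw [Subsingleton.elim (1 : C) 0, map_zero] at this
  exact zero_ne_one this

/-- If every nonzero `x* x` generates `1` as a closed `B`-invariant subspace, then intermediate
algebras, given as the range of `f`, are simple. -/
theorem isSimpleCStar_of_invariant {R : Type*} [Ring R] [Algebra ℂ R] [TopologicalSpace R]
    [Nontrivial C] (B : StarSubalgebra ℂ C)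
    (H : ∀ x : C, x ≠ 0 → ∀ J : Submodule ℂ C, star x * x ∈ J →
      (∀ b ∈ B, ∀ y ∈ J, star b * y * b ∈ J) → (1 : C) ∈ closure (J : Set C))
    (f : R →ₐ[ℂ] C) (hf : Topology.IsInducing f) (hf' : Function.Injective f)
    (hstar : ∀ r, ∃ r', f r' = star (f r)) (hB : ∀ b ∈ B, ∃ r, f r = b) : IsSimpleCStar R := by
  refine ⟨f.toRingHom.domain_nontrivial, fun J hJ => or_iff_not_imp_left.2 fun hne => ?_⟩
  obtain ⟨x, hxJ, hx⟩ : ∃ x ∈ J, x ≠ 0 := by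
    by_contra! h
    exact hne (le_antisymm (fun x hx => by rw [h x hx]; exact zero_mem _) bot_le)
  -- A two-sided ideal of a ring is only an additive subgroup a priori; scalars act on it through
  -- multiplication by `algebraMap`.
  let J' : Submodule ℂ C :=
    { carrier := f '' J
      zero_mem' := ⟨0, J.zero_mem, map_zero f⟩
      add_mem' := by
        rintro _ _ ⟨a, ha, rfl⟩ ⟨b, hb, rfl⟩
        exact ⟨a + b, J.add_mem ha hb, map_add f a b⟩
      smul_mem' := by
        rintro z _ ⟨a, ha, rfl⟩
        refine ⟨algebraMap ℂ R z * a, J.mul_mem_left _ _ ha, ?_⟩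
        rw [map_mul, AlgHom.commutes, Algebra.smul_def] }
  have h1 : (1 : C) ∈ closure (f '' J) := by
    refine H (f x) (fun h => hx (hf' (h.trans (map_zero f).symm))) J' ?_ ?_
    · obtain ⟨y, hy⟩ := hstar x
      exact ⟨y * x, J.mul_mem_left _ _ hxJ, by rw [map_mul, hy]⟩
    · rintro _ hb _ ⟨a, ha, rfl⟩
      obtain ⟨b, rfl⟩ := hB _ hb
      obtain ⟨b', hb'⟩ := hstar b
      exact ⟨b' * a * b, J.mul_mem_right _ _ (J.mul_mem_left _ _ ha), by
        rw [map_mul, map_mul, hb']⟩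
  have h2 : (1 : R) ∈ closure (J : Set R) := by
    rw [hf.closure_eq_preimage_closure_image]
    rwa [Set.mem_preimage, map_one]
  rw [hJ.closure_eq] at h2
  exact (TwoSidedIdeal.one_mem_iff J).1 h2

/-- The same argument applies to `C` through the identity map, and to `B` and every intermediate `D`
through their inclusions. -/
theorem isCStarIrreducible_of_invariant [Nontrivial C] (B : StarSubalgebra ℂ C)
    (H : ∀ x : C, x ≠ 0 → ∀ J : Submodule ℂ C, star x * x ∈ J →
      (∀ b ∈ B, ∀ y ∈ J, star b * y * b ∈ J) → (1 : C) ∈ closure (J : Set C)) :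
    IsCStarIrreducible B := by
  have hD : ∀ D : StarSubalgebra ℂ C, B ≤ D → IsSimpleCStar D := fun D hBD =>
    isSimpleCStar_of_invariant B H D.subtype.toAlgHom Topology.IsInducing.subtypeVal
      Subtype.val_injective (fun r => ⟨star r, rfl⟩) fun b hb => ⟨⟨b, hBD hb⟩, rfl⟩
  exact ⟨isSimpleCStar_of_invariant B H (AlgHom.id ℂ C) .id Function.injective_id
    (fun r => ⟨star r, rfl⟩) fun b _ => ⟨b, rfl⟩, hD B le_rfl, fun D _ => hD D⟩

theorem dixmierSet_subset_closure {B : StarSubalgebra ℂ C} {x : C} {J : Submodule ℂ C}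
    (hx : x ∈ J) (hJ : ∀ b ∈ B, ∀ y ∈ J, star b * y * b ∈ J) :
    dixmierSet B x ⊆ closure (J : Set C) := by
  refine closure_mono (convexHull_min ?_ (J.restrictScalars ℝ).convex)
  rintro _ ⟨u, -, hu, rfl⟩
  exact hJ u hu x hx

/-- The closure of an invariant subspace containing `x* x` contains its Dixmier set, hence the
scalar `φ (x* x)`, which is nonzero by faithfulness. -/
theorem isCStarIrreducible_of_mem_dixmierSet (B : StarSubalgebra ℂ C) (φ : CStarState C)
    (hφ : φ.IsFaithful) (h : ∀ x, algebraMap ℂ C (φ x) ∈ dixmierSet B x) :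
    IsCStarIrreducible B := by
  have := φ.nontrivial
  refine isCStarIrreducible_of_invariant B fun x hx J hxJ hJ => ?_
  have h1 : algebraMap ℂ C (φ (star x * x)) ∈ J.topologicalClosure :=
    dixmierSet_subset_closure hxJ hJ (h _)
  have h2 := J.topologicalClosure.smul_mem (φ (star x * x))⁻¹ h1
  rwa [Algebra.algebraMap_eq_smul_one, smul_smul, inv_mul_cancel₀ fun h0 => hx (hφ x h0),
    one_smul] at h2

end Irreducible

/-! ### Square roots and excision estimates -/

section Sqrt

variable {C : Type*} [CStarAlgebra C]

theorem cfc_sqrt_mul_self (k : C) :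
    cfc Real.sqrt (star k * k) * cfc Real.sqrt (star k * k) = star k * k := by
  have hs : IsSelfAdjoint (star k * k) := .star_mul_self k
  rw [← cfc_mul Real.sqrt Real.sqrt _ (by fun_prop) (by fun_prop)]
  conv_rhs => rw [← cfc_id ℝ (star k * k)]
  exact cfc_congr fun x hx => Real.mul_self_sqrt (spectrum_star_mul_self_nonneg x hx)

theorem exists_cfc_sqrt_eq (x : C) : ∃ k, cfc Real.sqrt x = star k * k := by
  let _ := CStarAlgebra.spectralOrder C
  have _ := CStarAlgebra.spectralOrderedRing C
  exact CStarAlgebra.nonneg_iff_eq_star_mul_self.1 (cfc_nonneg fun x _ => Real.sqrt_nonneg x)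

theorem isSelfAdjoint_cfc_sqrt (x : C) : IsSelfAdjoint (cfc Real.sqrt x) := by
  obtain ⟨k, hk⟩ := exists_cfc_sqrt_eq x
  rw [hk]
  exact .star_mul_self k

/-- Uniqueness of the positive square root, in the form used to identify square roots of elementary
tensors. -/
theorem cfc_sqrt_star_mul_self_mul (k : C) :
    cfc Real.sqrt (star k * k * (star k * k)) = star k * k := by
  have hs : IsSelfAdjoint (star k * k) := .star_mul_self k
  have e : star k * k * (star k * k) = cfc (fun x : ℝ => x * x) (star k * k) := by
    rw [cfc_mul (fun x : ℝ => x) (fun x => x) _ (by fun_prop) (by fun_prop), cfc_id' ℝ (star k * k)]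
  rw [e, ← cfc_comp' Real.sqrt _ _ (by fun_prop) (by fun_prop)]
  conv_rhs => rw [← cfc_id ℝ (star k * k)]
  exact cfc_congr fun x hx => Real.sqrt_mul_self (spectrum_star_mul_self_nonneg x hx)

theorem cfc_sqrt_mem {B : StarSubalgebra ℂ C} (hB : IsClosed (B : Set C)) {x : C} (hx : x ∈ B) :
    cfc Real.sqrt x ∈ B := by
  by_cases hs : IsSelfAdjoint x
  · rw [cfc_real_eq_complex Real.sqrt hs]
    exact StarAlgebra.elemental.le_of_mem hB hx (cfc_mem_elemental _ _)
  -- The functional calculus has the default value `0` here.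
  · rw [cfc_apply_of_not_predicate _ hs]
    exact zero_mem B

theorem norm_cfc_sqrt_le_one {k : C} (hk : ‖star k * k‖ = 1) :
    ‖cfc Real.sqrt (star k * k)‖ ≤ 1 := by
  have := CStarRing.norm_star_mul_self (x := cfc Real.sqrt (star k * k))
  rw [(isSelfAdjoint_cfc_sqrt _).star_eq, cfc_sqrt_mul_self, hk] at this
  nlinarith [norm_nonneg (cfc Real.sqrt (star k * k))]

/-- A bound independent of the excising element, so that excision extends from a dense subspace. -/
theorem norm_sqrt_mul_mul_sqrt_sub_le (φ : CStarState C) {k : C} (hk : ‖star k * k‖ = 1) (x : C) :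
    ‖cfc Real.sqrt (star k * k) * x * cfc Real.sqrt (star k * k) - φ x • (star k * k)‖
      ≤ 2 * ‖x‖ := by
  have h1 := norm_cfc_sqrt_le_one hk
  set r := cfc Real.sqrt (star k * k)
  refine (norm_sub_le _ _).trans ?_
  rw [norm_smul, hk, mul_one, two_mul]
  refine add_le_add ((norm_mul_le _ _).trans ?_) (φ.norm_apply_le x)
  refine (mul_le_of_le_one_right (norm_nonneg _) h1).trans ((norm_mul_le _ _).trans ?_)
  exact mul_le_of_le_one_left (norm_nonneg _) h1

theorem HasRelativeExcision.exists_norm_lt {B : StarSubalgebra ℂ C} {φ : CStarState C}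
    (h : HasRelativeExcision B φ) (T : Finset C) {ε : ℝ} (hε : 0 < ε) :
    ∃ x ∈ B, (∃ k, x = star k * k) ∧ ‖x‖ = 1 ∧ ∀ a ∈ T,
      ‖cfc Real.sqrt x * a * cfc Real.sqrt x - φ a • x‖ < ε := by
  obtain ⟨Λ, _, _, _, x, hx, hlim⟩ := h
  have := (Filter.eventually_all_finset T).2 fun a (_ : a ∈ T) =>
    (hlim a).eventually (gt_mem_nhds hε)
  obtain ⟨l, hl⟩ := this.exists
  exact ⟨x l, (hx l).1, (hx l).2.1, (hx l).2.2, hl⟩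

end Sqrt

/-! ### Excision of the product state -/

section ExcisionTensor

universe u v

variable {I : Type u} {A : I → Type v} [∀ i, CStarAlgebra (A i)]
  {B : ∀ i, StarSubalgebra ℂ (A i)}

open MinTensor

theorem MinTensor.tmul_eq_mul_incl (p : ElemTensor A) (j : I) :
    tmul p = tmul (ElemTensor.update p j 1) * incl j (p.1 j) := by
  rw [← tmul_update, ElemTensor.update_eq_self]

theorem ElemTensor.update_one_eq_one {p : ElemTensor A} {j : I} {S : Finset I}
    (h : ∀ i, i ≠ j → i ∉ S → p.1 i = 1) (i : I) (hi : i ∉ S) :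
    (ElemTensor.update p j 1).1 i = 1 := by
  by_cases hij : i = j
  · subst hij; simp
  · rw [ElemTensor.update_of_ne _ hij, h i hij hi]

theorem MinTensor.norm_tmul_le [Nontrivial (MinTensor A)] {M : ℝ} (hM : 1 ≤ M) (S : Finset I) :
    ∀ p : ElemTensor A, (∀ i, i ∉ S → p.1 i = 1) → (∀ i ∈ S, ‖p.1 i‖ ≤ M) →
      ‖tmul p‖ ≤ M ^ S.card := by
  classical
  induction S using Finset.induction_on with
  | empty =>
    intro p hp _
    have : p = 1 := ElemTensor.ext' fun i => hp i (by simp)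
    rw [this, tmul_one, CStarRing.norm_one, Finset.card_empty, pow_zero]
  | insert j S hj ih =>
    intro p hp hpM
    rw [tmul_eq_mul_incl p j, Finset.card_insert_of_notMem hj, pow_succ]
    refine (norm_mul_le _ _).trans (mul_le_mul (ih _ ?_ ?_)
      ((norm_incl_le _ _).trans (hpM j (Finset.mem_insert_self _ _))) (norm_nonneg _)
      (by positivity))
    · exact ElemTensor.update_one_eq_one fun i h h' => hp i (by simp [h, h'])
    · intro i hi
      rw [ElemTensor.update_of_ne _ (by rintro rfl; exact hj hi)]
      exact hpM i (Finset.mem_insert_of_mem hi)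

/-- Telescoping: `p` is turned into `q` one coordinate at a time. Since `M ≥ 1`, each change costs
at most `M ^ S.card * δ`. -/
theorem MinTensor.norm_tmul_sub_tmul_le [Nontrivial (MinTensor A)] {M δ : ℝ} (hM : 1 ≤ M)
    (S : Finset I) : ∀ p q : ElemTensor A, (∀ i, i ∉ S → p.1 i = 1) → (∀ i, i ∉ S → q.1 i = 1) →
      (∀ i ∈ S, ‖p.1 i‖ ≤ M) → (∀ i ∈ S, ‖q.1 i‖ ≤ M) → (∀ i ∈ S, ‖p.1 i - q.1 i‖ ≤ δ) →
      ‖tmul p - tmul q‖ ≤ S.card * M ^ S.card * δ := by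
  classical
  induction S using Finset.induction_on with
  | empty =>
    intro p q hp hq _ _ _
    have : p = q := ElemTensor.ext' fun i => by rw [hp i (by simp), hq i (by simp)]
    simp [this]
  | insert j S hj ih =>
    intro p q hp hq hpM hqM hpq
    have hne : ∀ i ∈ S, i ≠ j := by rintro i hi rfl; exact hj hi
    have hp' := ElemTensor.update_one_eq_one (p := p) (j := j) (S := S)
      fun i h h' => hp i (by simp [h, h'])
    have hq' := ElemTensor.update_one_eq_one (p := q) (j := j) (S := S)
      fun i h h' => hq i (by simp [h, h'])
    have hpM' : ∀ i ∈ S, ‖(ElemTensor.update p j 1).1 i‖ ≤ M := fun i hi => by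
      rw [ElemTensor.update_of_ne _ (hne i hi)]; exact hpM i (Finset.mem_insert_of_mem hi)
    have hqM' : ∀ i ∈ S, ‖(ElemTensor.update q j 1).1 i‖ ≤ M := fun i hi => by
      rw [ElemTensor.update_of_ne _ (hne i hi)]; exact hqM i (Finset.mem_insert_of_mem hi)
    have h1 := ih _ _ hp' hq' hpM' hqM' fun i hi => by
      rw [ElemTensor.update_of_ne _ (hne i hi), ElemTensor.update_of_ne _ (hne i hi)]
      exact hpq i (Finset.mem_insert_of_mem hi)
    have h2 := norm_tmul_le hM S _ hq' hqM'
    have hj1 : ‖(incl j (p.1 j) : MinTensor A)‖ ≤ M :=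
      (norm_incl_le _ _).trans (hpM j (Finset.mem_insert_self _ _))
    have hj2 : ‖(incl j (p.1 j - q.1 j) : MinTensor A)‖ ≤ δ :=
      (norm_incl_le _ _).trans (hpq j (Finset.mem_insert_self _ _))
    have hδ : 0 ≤ δ := (norm_nonneg _).trans hj2
    have e : tmul p - tmul q =
        (tmul (ElemTensor.update p j 1) - tmul (ElemTensor.update q j 1)) * incl j (p.1 j)
        + tmul (ElemTensor.update q j 1) * incl j (p.1 j - q.1 j) := by
      rw [tmul_eq_mul_incl p j, tmul_eq_mul_incl q j, map_sub (incl j), mul_sub, sub_mul]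
      abel
    rw [e, Finset.card_insert_of_notMem hj]
    refine (norm_add_le _ _).trans ((add_le_add
      ((norm_mul_le _ _).trans (mul_le_mul h1 hj1 (norm_nonneg _) (by positivity)))
      ((norm_mul_le _ _).trans (mul_le_mul h2 hj2 (norm_nonneg _) (by positivity)))).trans ?_)
    have h3 : M ^ S.card * δ ≤ M ^ S.card * M * δ :=
      mul_le_mul_of_nonneg_right (le_mul_of_one_le_right (by positivity) hM) hδ
    push_cast
    rw [pow_succ]
    linarith

theorem MinTensor.tmul_smul (S : Finset I) : ∀ (z : I → ℂ) (p q : ElemTensor A),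
    (∀ i ∈ S, q.1 i = z i • p.1 i) → (∀ i, i ∉ S → q.1 i = p.1 i) →
      tmul q = (∏ i ∈ S, z i) • tmul p := by
  classical
  induction S using Finset.induction_on with
  | empty =>
    intro z p q _ h
    rw [ElemTensor.ext' fun i => h i (by simp), Finset.prod_empty, one_smul]
  | insert j S hj ih =>
    intro z p q h h'
    have e := ih z p (ElemTensor.update q j (p.1 j)) (fun i hi => by
        rw [ElemTensor.update_of_ne _ (by rintro rfl; exact hj hi),
          h i (Finset.mem_insert_of_mem hi)])
      fun i hi => by
        by_cases hij : i = j
        · subst hij; simp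
        · rw [ElemTensor.update_of_ne _ hij, h' i (by simp [hi, hij])]
    rw [Finset.prod_insert hj, mul_smul, ← e, ← tmul_update_smul,
      ← h j (Finset.mem_insert_self _ _), ElemTensor.update_eq_self]

/-- The coordinatewise square root of an elementary tensor. -/
def ElemTensor.sqrt (c : ElemTensor A) : ElemTensor A :=
  ⟨fun i => cfc Real.sqrt (c.1 i), c.2.subset fun i hi h => hi (by
    change cfc Real.sqrt (c.1 i) = 1
    rw [h, cfc_apply_one (R := ℝ)]; simp)⟩

/-- The tensor of coordinatewise square roots squares to `tmul h` and is itself positive, being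
built from squares of self-adjoint fourth roots. Uniqueness of the positive square root applies. -/
theorem MinTensor.cfc_sqrt_tmul {h : ElemTensor A} (hp : ∀ i, ∃ k, h.1 i = star k * k) :
    cfc Real.sqrt (tmul h) = tmul (ElemTensor.sqrt h) := by
  have h1 : ElemTensor.sqrt h * ElemTensor.sqrt h = h := ElemTensor.ext' fun i => by
    obtain ⟨k, hk⟩ := hp i
    change cfc Real.sqrt (h.1 i) * cfc Real.sqrt (h.1 i) = h.1 i
    rw [hk, cfc_sqrt_mul_self]
  have h2 : star (ElemTensor.sqrt (ElemTensor.sqrt h)) * ElemTensor.sqrt (ElemTensor.sqrt h)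
      = ElemTensor.sqrt h := ElemTensor.ext' fun i => by
    change star (cfc Real.sqrt (cfc Real.sqrt (h.1 i))) * cfc Real.sqrt (cfc Real.sqrt (h.1 i))
      = cfc Real.sqrt (h.1 i)
    obtain ⟨k, hk⟩ := exists_cfc_sqrt_eq (h.1 i)
    rw [hk, (isSelfAdjoint_cfc_sqrt _).star_eq, cfc_sqrt_mul_self]
  conv_lhs => rw [← h1, ← h2, tmul_mul, tmul_mul, tmul_star]
  rw [cfc_sqrt_star_mul_self_mul, ← tmul_star, ← tmul_mul, h2]

theorem MinTensor.exists_tmul_eq_star_mul {h : ElemTensor A}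
    (hp : ∀ i, ∃ k, h.1 i = star k * k) : ∃ k, tmul h = star k * k := by
  refine ⟨tmul (ElemTensor.sqrt h), ?_⟩
  rw [← tmul_star, ← tmul_mul]
  congr 1
  refine ElemTensor.ext' fun i => ?_
  obtain ⟨k, hk⟩ := hp i
  change h.1 i = star (cfc Real.sqrt (h.1 i)) * cfc Real.sqrt (h.1 i)
  rw [(isSelfAdjoint_cfc_sqrt _).star_eq, hk, cfc_sqrt_mul_self]

/-- For the lower bound, choose at each coordinate a state with value above `r < 1`. Their product
state gives at least `r ^ S.card`, and `r` tends to `1`. -/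
theorem MinTensor.norm_tmul_eq_one [Nontrivial (MinTensor A)] {h : ElemTensor A}
    (hp : ∀ i, ∃ k, h.1 i = star k * k) (hn : ∀ i, ‖h.1 i‖ = 1) : ‖tmul h‖ = 1 := by
  obtain ⟨S, hS⟩ := ElemTensor.exists_finset h
  refine le_antisymm ((norm_tmul_le le_rfl S h hS fun i _ => (hn i).le).trans (one_pow _).le) ?_
  have key : ∀ r ∈ Set.Ico (0 : ℝ) 1, r ^ S.card ≤ ‖tmul h‖ := fun r hr => by
    have : ∀ i, ∃ φ : CStarState (A i), r < (φ (h.1 i)).re := fun i => by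
      obtain ⟨k, hk⟩ := hp i
      rw [hk]
      exact CStarState.exists_lt_re (by rw [← hk, hn]) hr.1 hr.2
    choose φ hφ using this
    refine le_trans ?_ ((productState φ).norm_apply_le (tmul h))
    rw [productState_tmul_eq_prod φ h S hS, norm_prod, ← Finset.prod_const]
    exact Finset.prod_le_prod (fun _ _ => hr.1) fun i _ =>
      (hφ i).le.trans ((le_abs_self _).trans (Complex.abs_re_le_norm _))
  have ht : Filter.Tendsto (fun r : ℝ => r ^ S.card) (nhdsWithin 1 (Set.Iio 1)) (nhds 1) := by
    have : ContinuousAt (fun r : ℝ => r ^ S.card) 1 := by fun_prop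
    have h2 := this.tendsto
    rw [one_pow] at h2
    exact h2.mono_left nhdsWithin_le_nhds
  refine le_of_tendsto ht ?_
  filter_upwards [Ico_mem_nhdsLT (zero_lt_one (α := ℝ))] with r hr using key r hr

variable {ψ : ∀ i, CStarState (A i)}

/-- Excising elements are chosen at the finitely many coordinates where `T` is nontrivial, and `1`
elsewhere. Both sides of the excision estimate become elementary tensors with nearby coordinates. -/
theorem exists_excision_tmul (hB : ∀ i, HasRelativeExcision (B i) (ψ i))
    (T : Finset (ElemTensor A)) {ε : ℝ} (hε : 0 < ε) :
    ∃ h : ElemTensor A, (∀ i, h.1 i ∈ B i ∧ (∃ k, h.1 i = star k * k) ∧ ‖h.1 i‖ = 1) ∧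
      ∀ c ∈ T, ‖cfc Real.sqrt (tmul h) * tmul c * cfc Real.sqrt (tmul h)
        - productState ψ (tmul c) • tmul h‖ < ε := by
  classical
  have := (productState ψ).nontrivial
  have hA : ∀ i, Nontrivial (A i) := fun i => (ψ i).nontrivial
  obtain ⟨S, hS⟩ := exists_finset_support T
  set M : ℝ := 1 + ∑ c ∈ T, ∑ i ∈ S, ‖c.1 i‖ with hM
  have hM1 : 1 ≤ M := le_add_of_nonneg_right (Finset.sum_nonneg fun c _ =>
    Finset.sum_nonneg fun i _ => norm_nonneg _)
  have hcM : ∀ c ∈ T, ∀ i ∈ S, ‖c.1 i‖ ≤ M := fun c hc i hi => by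
    have h1 := Finset.single_le_sum (f := fun i => ‖c.1 i‖) (fun i _ => norm_nonneg _) hi
    have h2 := Finset.single_le_sum (f := fun c : ElemTensor A => ∑ i ∈ S, ‖c.1 i‖)
      (fun c _ => Finset.sum_nonneg fun i _ => norm_nonneg _) hc
    linarith
  -- Chosen so that the telescoping bound `S.card * M ^ S.card * δ` is below `ε`.
  set δ : ℝ := ε / (S.card * M ^ S.card + 1) with hδ
  have hδ0 : 0 < δ := by positivity
  choose x hxB hxp hxn hx using fun i => (hB i).exists_norm_lt (T.image fun c => c.1 i) hδ0
  let h : ElemTensor A := ⟨fun i => if i ∈ S then x i else 1, S.finite_toSet.subset fun i hi => by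
    by_contra hn
    exact hi (if_neg hn)⟩
  have hin : ∀ i ∈ S, h.1 i = x i := fun i hi => if_pos hi
  have hout : ∀ i, i ∉ S → h.1 i = 1 := fun i hi => if_neg hi
  have hh : ∀ i, h.1 i ∈ B i ∧ (∃ k, h.1 i = star k * k) ∧ ‖h.1 i‖ = 1 := fun i => by
    by_cases hi : i ∈ S
    · rw [hin i hi]; exact ⟨hxB i, hxp i, hxn i⟩
    · rw [hout i hi]; exact ⟨one_mem _, ⟨1, by simp⟩, CStarRing.norm_one⟩
  refine ⟨h, hh, fun c hc => ?_⟩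
  have hsq : ∀ i, i ∉ S → (ElemTensor.sqrt h).1 i = 1 := fun i hi => by
    change cfc Real.sqrt (h.1 i) = 1
    rw [hout i hi, cfc_apply_one (R := ℝ)]; simp
  -- The scalar of the product state is distributed over the coordinates.
  let q : ElemTensor A := ⟨fun i => ψ i (c.1 i) • h.1 i, S.finite_toSet.subset fun i hi => by
    by_contra hn
    refine hi ?_
    change ψ i (c.1 i) • h.1 i = 1
    rw [hS c hc i hn, hout i hn, CStarState.map_one, one_smul]⟩
  have hq : tmul q = productState ψ (tmul c) • tmul h := by
    rw [productState_tmul_eq_prod ψ c S (hS c hc)]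
    refine tmul_smul S _ _ _ (fun _ _ => rfl) fun i hi => ?_
    change ψ i (c.1 i) • h.1 i = h.1 i
    rw [hS c hc i hi, CStarState.map_one, one_smul]
  rw [cfc_sqrt_tmul fun i => (hh i).2.1, ← tmul_mul, ← tmul_mul, ← hq]
  refine (norm_tmul_sub_tmul_le (δ := δ) hM1 S _ _ (fun i hi => ?_) (fun i hi => ?_)
    (fun i hi => ?_) (fun i hi => ?_) fun i hi => ?_).trans_lt ?_
  · simp [hsq i hi, hS c hc i hi]
  · change ψ i (c.1 i) • h.1 i = 1
    rw [hS c hc i hi, hout i hi, CStarState.map_one, one_smul]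
  · change ‖cfc Real.sqrt (h.1 i) * c.1 i * cfc Real.sqrt (h.1 i)‖ ≤ M
    obtain ⟨k, hk⟩ := (hh i).2.1
    have h1 := norm_cfc_sqrt_le_one (k := k) (by rw [← hk, (hh i).2.2])
    rw [hk]
    refine ((norm_mul_le _ _).trans ((mul_le_of_le_one_right (norm_nonneg _) h1).trans
      ((norm_mul_le _ _).trans ?_))).trans (hcM c hc i hi)
    exact mul_le_of_le_one_left (norm_nonneg _) h1
  · change ‖ψ i (c.1 i) • h.1 i‖ ≤ M
    rw [norm_smul, (hh i).2.2, mul_one]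
    exact ((ψ i).norm_apply_le _).trans (hcM c hc i hi)
  · change ‖cfc Real.sqrt (h.1 i) * c.1 i * cfc Real.sqrt (h.1 i) - ψ i (c.1 i) • h.1 i‖ ≤ δ
    rw [hin i hi]
    exact (hx i _ (Finset.mem_image_of_mem _ hc)).le
  · rw [hδ, mul_div_assoc', div_lt_iff₀ (by positivity)]
    linarith

/-- The net of elementary tensors that excises the product state. -/
theorem exists_excision_net (hB : ∀ i, HasRelativeExcision (B i) (ψ i)) :
    ∃ h : Finset (ElemTensor A) × ℕ → ElemTensor A,
      (∀ l i, (h l).1 i ∈ B i ∧ (∃ k, (h l).1 i = star k * k) ∧ ‖(h l).1 i‖ = 1) ∧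
      ∀ x : MinTensor A, Filter.Tendsto (fun l => ‖cfc Real.sqrt (tmul (h l)) * x *
        cfc Real.sqrt (tmul (h l)) - productState ψ x • tmul (h l)‖) Filter.atTop (nhds 0) := by
  classical
  have := (productState ψ).nontrivial
  -- The index `(T, n)` demands tolerance `1 / (n + 1)` on all of `T`.
  choose h hh hlim using fun l : Finset (ElemTensor A) × ℕ =>
    exists_excision_tmul hB l.1 (ε := 1 / (l.2 + 1)) (by positivity)
  refine ⟨h, hh, fun x => ?_⟩
  set r := fun l => cfc Real.sqrt (tmul (h l))
  have hle : ∀ l x, ‖r l * x * r l - productState ψ x • tmul (h l)‖ ≤ 2 * ‖x‖ := fun l x => by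
    have h1 := norm_tmul_eq_one (fun i => (hh l i).2.1) fun i => (hh l i).2.2
    obtain ⟨k, hk⟩ := exists_tmul_eq_star_mul fun i => (hh l i).2.1
    change ‖cfc Real.sqrt (tmul (h l)) * x * cfc Real.sqrt (tmul (h l)) - _‖ ≤ _
    rw [hk] at h1 ⊢
    exact norm_sqrt_mul_mul_sqrt_sub_le _ h1 x
  change Filter.Tendsto (fun l => ‖r l * x * r l - productState ψ x • tmul (h l)‖) _ _
  rw [← tendsto_zero_iff_norm_tendsto_zero]
  induction x using MinTensor.induction_on with
  | ht c =>
    rw [Metric.tendsto_atTop]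
    intro ε hε
    obtain ⟨n, hn⟩ := exists_nat_one_div_lt hε
    refine ⟨({c}, n), fun l hl => ?_⟩
    rw [dist_zero_right]
    refine (hlim l c (hl.1 (Finset.mem_singleton_self c))).trans (lt_of_le_of_lt ?_ hn)
    exact Nat.one_div_le_one_div hl.2
  | ha x y hx hy =>
    have := hx.add hy
    rw [add_zero] at this
    refine this.congr fun l => ?_
    rw [mul_add, add_mul, map_add, add_smul]
    abel
  | hs z x hx =>
    have := hx.const_smul z
    rw [smul_zero] at this
    refine this.congr fun l => ?_
    rw [smul_sub, map_smul, mul_smul_comm, smul_mul_assoc, smul_smul, smul_eq_mul]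
  | hc =>
    refine isClosed_of_closure_subset fun x hx => Metric.tendsto_atTop.2 fun ε hε => ?_
    -- The bound `2 * ‖x - y‖` makes `ε / 4` contribute less than `ε / 2`.
    obtain ⟨y, hy, hxy⟩ := Metric.mem_closure_iff.1 hx (ε / 4) (by positivity)
    obtain ⟨N, hN⟩ := Metric.tendsto_atTop.1 hy (ε / 2) (by positivity)
    refine ⟨N, fun l hl => ?_⟩
    have h1 := hN l hl
    have h2 := hle l (x - y)
    rw [dist_eq_norm] at hxy
    rw [dist_zero_right] at h1 ⊢
    have e : r l * x * r l - productState ψ x • tmul (h l) =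
        (r l * (x - y) * r l - productState ψ (x - y) • tmul (h l)) +
        (r l * y * r l - productState ψ y • tmul (h l)) := by
      rw [map_sub, sub_smul, mul_sub, sub_mul]; abel
    rw [e]
    refine (norm_add_le _ _).trans_lt ?_
    linarith

theorem hasRelativeExcision_subTensor (hB : ∀ i, HasRelativeExcision (B i) (ψ i)) :
    HasRelativeExcision (subTensor B) (productState ψ) := by
  classical
  have := (productState ψ).nontrivial
  obtain ⟨h, hh, hlim⟩ := exists_excision_net hB
  refine ⟨Finset (ElemTensor A) × ℕ, inferInstance, inferInstance, inferInstance,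
    fun l => tmul (h l), fun l => ⟨tmul_mem_subTensor fun i => (hh l i).1,
      exists_tmul_eq_star_mul fun i => (hh l i).2.1,
      norm_tmul_eq_one (fun i => (hh l i).2.1) fun i => (hh l i).2.2⟩, hlim⟩

end ExcisionTensor

/-! ### Sums of conjugations by elements of a subalgebra -/

section ConjSum

variable {C : Type*} [CStarAlgebra C] {B : StarSubalgebra ℂ C}

/-- The map `x ↦ b* x b`. -/
def conjMap (b : C) : C →ₗ[ℂ] C := LinearMap.mulRight ℂ b ∘ₗ LinearMap.mulLeft ℂ (star b)

theorem conjMap_apply (b x : C) : conjMap b x = star b * x * b := rfl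

/-- The finite sums of maps `x ↦ b* x b` with `b ∈ B`. -/
def conjSum (B : StarSubalgebra ℂ C) : AddSubmonoid (C →ₗ[ℂ] C) :=
  AddSubmonoid.closure {F | ∃ b ∈ B, conjMap b = F}

theorem conjMap_mem_conjSum {b : C} (hb : b ∈ B) : conjMap b ∈ conjSum B :=
  AddSubmonoid.subset_closure ⟨b, hb, rfl⟩

theorem comp_mem_conjSum {F G : C →ₗ[ℂ] C} (hF : F ∈ conjSum B) (hG : G ∈ conjSum B) :
    F ∘ₗ G ∈ conjSum B := by
  induction hF using AddSubmonoid.closure_induction with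
  | mem F hF =>
    obtain ⟨b, hb, rfl⟩ := hF
    induction hG using AddSubmonoid.closure_induction with
    | mem G hG =>
      obtain ⟨d, hd, rfl⟩ := hG
      have : conjMap b ∘ₗ conjMap d = conjMap (d * b) := by
        ext x
        simp [conjMap_apply, mul_assoc]
      rw [this]
      exact conjMap_mem_conjSum (mul_mem hd hb)
    | zero => rw [LinearMap.comp_zero]; exact zero_mem _
    | add G G' _ _ h h' => rw [LinearMap.comp_add]; exact add_mem h h'
  | zero => rw [LinearMap.zero_comp]; exact zero_mem _
  | add F F' _ _ h h' => rw [LinearMap.add_comp]; exact add_mem h h'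

/-- An additive submonoid suffices, so both the positive cone and invariant subspaces are covered.
-/
theorem conjSum_apply_mem {F : C →ₗ[ℂ] C} (hF : F ∈ conjSum B) {J : AddSubmonoid C}
    (hJ : ∀ b ∈ B, ∀ y ∈ J, star b * y * b ∈ J) {x : C} (hx : x ∈ J) : F x ∈ J := by
  induction hF using AddSubmonoid.closure_induction with
  | mem F hF => obtain ⟨b, hb, rfl⟩ := hF; exact hJ b hb x hx
  | zero => exact zero_mem _
  | add F F' _ _ h h' => exact add_mem h h'

theorem conjSum_apply_star {F : C →ₗ[ℂ] C} (hF : F ∈ conjSum B) (x : C) :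
    F (star x) = star (F x) := by
  induction hF using AddSubmonoid.closure_induction with
  | mem F hF => obtain ⟨b, hb, rfl⟩ := hF; simp [conjMap_apply, mul_assoc]
  | zero => simp
  | add F F' _ _ h h' => rw [LinearMap.add_apply, LinearMap.add_apply, h, h', star_add]

variable [PartialOrder C] [StarOrderedRing C]

theorem conjSum_apply_nonneg {F : C →ₗ[ℂ] C} (hF : F ∈ conjSum B) {x : C} (hx : 0 ≤ x) :
    0 ≤ F x :=
  conjSum_apply_mem hF (J := AddSubmonoid.nonneg C)
    (fun b _ _ hy => star_left_conjugate_nonneg hy b) hx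

theorem conjSum_apply_mono {F : C →ₗ[ℂ] C} (hF : F ∈ conjSum B) {x y : C} (hx : x ≤ y) :
    F x ≤ F y := by
  rw [← sub_nonneg, ← map_sub]
  exact conjSum_apply_nonneg hF (sub_nonneg.2 hx)

end ConjSum

section

variable {C : Type*} [CStarAlgebra C] {B : StarSubalgebra ℂ C}

/-- A positive unital map preserves the order interval between `-‖x‖` and `‖x‖`; the number of
summands plays no role. -/
theorem norm_conjSum_apply_le {F : C →ₗ[ℂ] C} (hF : F ∈ conjSum B) (h1 : F 1 = 1) {x : C}
    (hx : IsSelfAdjoint x) : ‖F x‖ ≤ ‖x‖ := by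
  let _ := CStarAlgebra.spectralOrder C
  have _ := CStarAlgebra.spectralOrderedRing C
  have hs : IsSelfAdjoint (F x) := by
    rw [IsSelfAdjoint, ← conjSum_apply_star hF, hx.star_eq]
  have hr : F (algebraMap ℝ C ‖x‖) = algebraMap ℝ C ‖x‖ := by
    rw [Algebra.algebraMap_eq_smul_one, ← Complex.coe_smul, map_smul, h1]
  refine hs.norm_le_of_mem_Icc (norm_nonneg x) ?_ ?_
  · rw [← hr, ← map_neg]
    exact conjSum_apply_mono hF hx.neg_algebraMap_norm_le_self
  · rw [← hr]
    exact conjSum_apply_mono hF hx.le_algebraMap_norm_self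

end

/-! ### Moving a positive norm-one element to `1` in a simple algebra -/

section Simple

variable {R : Type*} [CStarAlgebra R]

/-- The closure of the ideal is everything, so the ideal itself has an element at distance less than
`1` from `1`, and that element is invertible. -/
theorem IsSimpleCStar.one_mem_span (hR : IsSimpleCStar R) {k : R} (hk : k ≠ 0) :
    (1 : R) ∈ TwoSidedIdeal.span {k} := by
  set J := TwoSidedIdeal.span ({k} : Set R) with hJ
  have h0 : (0 : R) ∈ closure (J : Set R) := subset_closure J.zero_mem
  let K : TwoSidedIdeal R := TwoSidedIdeal.mk' (closure (J : Set R)) h0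
    (fun hx hy => map_mem_closure₂ continuous_add hx hy fun _ ha _ hb => J.add_mem ha hb)
    (fun hx => map_mem_closure continuous_neg hx fun _ ha => J.neg_mem ha)
    (fun {x y} hy => map_mem_closure (continuous_const_mul x) hy fun _ ha => J.mul_mem_left _ _ ha)
    (fun {x y} hx => map_mem_closure (f := (· * y)) (continuous_mul_const y) hx fun _ ha => J.mul_mem_right _ _ ha)
  have hK : (K : Set R) = closure (J : Set R) := TwoSidedIdeal.coe_mk' _ _ _ _ _ _
  have hkK : k ∈ K := by
    change k ∈ (K : Set R)
    rw [hK]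
    exact subset_closure (TwoSidedIdeal.subset_span rfl)
  have h1 : (1 : R) ∈ closure (J : Set R) := by
    rw [← hK]
    rcases hR.2 K (by rw [hK]; exact isClosed_closure) with h | h
    · rw [h] at hkK; exact (hk hkK).elim
    · rw [h]; trivial
  obtain ⟨w, hw, hw1⟩ := Metric.mem_closure_iff.1 h1 1 one_pos
  rw [dist_eq_norm] at hw1
  have hu := (Units.oneSub (1 - w) hw1).inv_mul
  rw [Units.val_oneSub, sub_sub_cancel] at hu
  rw [← hu]
  exact J.mul_mem_left _ _ hw

variable [PartialOrder R] [StarOrderedRing R]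

/-- For `w = k` this is the expansion of `(c* - d)* k (c* - d) ≥ 0`. Allowing arbitrary outer
factors `c` and `d` makes the absorption steps of the induction immediate. -/
theorem exists_add_star_le_conjSum {k w : R} (hk : 0 ≤ k) (hw : w ∈ TwoSidedIdeal.span {k}) :
    ∀ c d : R, ∃ F ∈ conjSum (⊤ : StarSubalgebra ℂ R), c * w * d + star (c * w * d) ≤ F k := by
  have hks : star k = k := (IsSelfAdjoint.of_nonneg hk).star_eq
  induction hw using TwoSidedIdeal.span_induction with
  | mem x hx =>
    intro c d
    rw [Set.mem_singleton_iff.1 hx]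
    refine ⟨conjMap (star c) + conjMap d, add_mem (conjMap_mem_conjSum trivial)
      (conjMap_mem_conjSum trivial), sub_nonneg.1 ?_⟩
    convert star_left_conjugate_nonneg hk (star c - d) using 1
    simp only [LinearMap.add_apply, conjMap_apply, star_mul, star_sub, star_star, hks]
    noncomm_ring
  | zero => exact fun c d => ⟨0, zero_mem _, by simp⟩
  | add x y _ _ hx hy =>
    intro c d
    obtain ⟨F, hF, h⟩ := hx c d
    obtain ⟨G, hG, h'⟩ := hy c d
    refine ⟨F + G, add_mem hF hG, ?_⟩
    rw [mul_add, add_mul, star_add, add_add_add_comm]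
    exact add_le_add h h'
  | neg x _ hx =>
    intro c d
    obtain ⟨F, hF, h⟩ := hx (-c) d
    refine ⟨F, hF, ?_⟩
    rwa [mul_neg, ← neg_mul]
  | left_absorb a x _ hx =>
    intro c d
    obtain ⟨F, hF, h⟩ := hx (c * a) d
    refine ⟨F, hF, ?_⟩
    rwa [← mul_assoc c]
  | right_absorb b x _ hx =>
    intro c d
    obtain ⟨F, hF, h⟩ := hx c (b * d)
    refine ⟨F, hF, ?_⟩
    rwa [← mul_assoc c, mul_assoc _ b d]

/-- With `w = c = d = 1` the preceding inequality gives `F k ≥ 2`. So `F k` is invertible, and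
conjugation by `(F k)^{-1/2}` normalises it. -/
theorem IsSimpleCStar.exists_conjSum_eq_one (hR : IsSimpleCStar R) {k : R} (hk : 0 ≤ k)
    (hk0 : k ≠ 0) : ∃ F ∈ conjSum (⊤ : StarSubalgebra ℂ R), F k = 1 := by
  obtain ⟨F, hF, h⟩ := exists_add_star_le_conjSum hk (hR.one_mem_span hk0) 1 1
  have h1 : (1 : R) ≤ F k := by
    refine le_trans ?_ h
    simp
  have hp : IsStrictlyPositive (F k) := isStrictlyPositive_one.of_le h1
  set s : R := (F k) ^ (-(1 / 2) : ℝ) with hs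
  have hss : star s = s := (IsSelfAdjoint.of_nonneg (CFC.rpow_nonneg)).star_eq
  refine ⟨conjMap s ∘ₗ F, comp_mem_conjSum (conjMap_mem_conjSum trivial) hF, ?_⟩
  rw [LinearMap.comp_apply, conjMap_apply, hss]
  exact CFC.conjugate_rpow_neg_one_half (F k)

/-- With `g = f(h)` for `f` vanishing below `1 - η`, one has `(1 - η) g² ≤ g h g ≤ g²`. A sum of
conjugations sending `g²` to `1` sends `g h g` into the interval from `1 - η` to `1`. -/
theorem IsSimpleCStar.exists_conjSum_near_one (hR : IsSimpleCStar R) {h : R} (hh : 0 ≤ h)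
    (hn : ‖h‖ = 1) {η : ℝ} (hη : 0 < η) :
    ∃ F ∈ conjSum (⊤ : StarSubalgebra ℂ R), F 1 = 1 ∧ ‖F h - 1‖ ≤ η := by
  have : Nontrivial R := hR.1
  have hsa : IsSelfAdjoint h := .of_nonneg hh
  -- `Real.sqrt` is `0` on negative numbers, so `f` vanishes below `1 - η`. At the spectral value
  -- `1` one has `f² = η > 0`, whence `g ≠ 0`.
  set f : ℝ → ℝ := fun t => Real.sqrt (t - (1 - η)) with hf
  have hfc : Continuous f := by fun_prop
  set g := cfc f h with hg
  have hgs : star g = g := (cfc_predicate f h : IsSelfAdjoint g).star_eq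
  have hgg : star g * g = cfc (fun t => f t * f t) h := by rw [hgs, hg, ← cfc_mul f f h]
  have hghg : star g * h * g = cfc (fun t => f t * t * f t) h := by
    rw [hgs, hg, cfc_mul (fun t => f t * t) f h, cfc_mul f (fun t => t) h, cfc_id' ℝ h]
  have h1 : (1 : ℝ) ∈ spectrum ℝ h := hn ▸ CStarAlgebra.norm_mem_spectrum_of_nonneg hh
  have hne : star g * g ≠ 0 := fun h0 => by
    rw [hgg, ← cfc_zero ℝ h, cfc_eq_cfc_iff_eqOn] at h0
    have := h0 h1
    simp only [hf, Pi.zero_apply, sub_sub_cancel, Real.mul_self_sqrt hη.le] at this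
    exact hη.ne' this
  obtain ⟨F, hF, hF1⟩ := hR.exists_conjSum_eq_one (star_mul_self_nonneg g) hne
  refine ⟨F ∘ₗ conjMap g, comp_mem_conjSum hF (conjMap_mem_conjSum trivial), ?_, ?_⟩
  · rw [LinearMap.comp_apply, conjMap_apply, mul_one, hF1]
  · rw [LinearMap.comp_apply, conjMap_apply]
    have hlow : (1 - η) • (star g * g) ≤ star g * h * g := by
      rw [hghg, hgg, ← cfc_smul (1 - η) (fun t => f t * f t) h]
      refine (cfc_le_iff _ _ h).2 fun t _ => ?_
      rcases le_total t (1 - η) with ht | ht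
      · simp [hf, Real.sqrt_eq_zero_of_nonpos (sub_nonpos.2 ht)]
      · rw [smul_eq_mul]
        nlinarith [mul_self_nonneg (f t)]
    have hup : star g * h * g ≤ star g * g := by
      rw [← sub_nonneg]
      have h2 : 0 ≤ 1 - h := sub_nonneg.2 ((CStarAlgebra.norm_le_one_iff_of_nonneg h hh).1 hn.le)
      convert star_left_conjugate_nonneg h2 g using 1
      noncomm_ring
    have hlow' := conjSum_apply_mono hF hlow
    have hup' := conjSum_apply_mono hF hup
    rw [← Complex.coe_smul, map_smul, hF1, Complex.coe_smul] at hlow'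
    rw [hF1] at hup'
    have hs : IsSelfAdjoint (F (star g * h * g)) := by
      rw [IsSelfAdjoint, ← conjSum_apply_star hF]
      congr 1
      simp [mul_assoc, hsa.star_eq]
    refine (hs.sub (.one R)).norm_le_of_mem_Icc hη.le ?_ ?_
    · rw [Algebra.algebraMap_eq_smul_one]
      rw [sub_smul, one_smul] at hlow'
      rw [neg_le_sub_iff_le_add]
      exact sub_le_iff_le_add.1 hlow'
    · refine (sub_nonpos.2 hup').trans ?_
      rw [Algebra.algebraMap_eq_smul_one]
      exact smul_nonneg hη.le zero_le_one

end Simple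

/-! ### Irreducibility from excision and simple factors -/

section ExcisionIrreducible

universe u v

variable {I : Type u} {A : I → Type v} [∀ i, CStarAlgebra (A i)]
  {B : ∀ i, StarSubalgebra ℂ (A i)}

open MinTensor

/-- Conjugation by `d` in `B j` lifts to conjugation by `incl j d`; sums lift by multilinearity. -/
theorem exists_conjSum_subTensor (j : I) [IsClosed (B j : Set (A j))] {f : B j →ₗ[ℂ] B j}
    (hf : f ∈ conjSum (⊤ : StarSubalgebra ℂ (B j))) :
    ∃ F ∈ conjSum (subTensor B), ∀ c (b : B j),
      F (tmul (ElemTensor.update c j (b : A j))) = tmul (ElemTensor.update c j (f b : A j)) := by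
  induction hf using AddSubmonoid.closure_induction with
  | mem f hf =>
    obtain ⟨d, -, rfl⟩ := hf
    refine ⟨conjMap (incl j (d : A j)), conjMap_mem_conjSum (incl_mem_subTensor d.2),
      fun c b => ?_⟩
    rw [conjMap_apply, ← map_star (incl j), incl_mul_tmul_update, tmul_update_mul_incl]
    rfl
  | zero =>
    refine ⟨0, zero_mem _, fun c b => ?_⟩
    have := tmul_update_smul c j 0 0
    rw [zero_smul, zero_smul] at this
    exact this.symm
  | add f g _ _ hf hg =>
    obtain ⟨F, hF, h⟩ := hf
    obtain ⟨G, hG, h'⟩ := hg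
    refine ⟨F + G, add_mem hF hG, fun c b => ?_⟩
    rw [LinearMap.add_apply, h, h', ← tmul_update_add]
    rfl

theorem exists_conjSum_coord (j : I) (hcl : IsClosed (B j : Set (A j)))
    (hs : IsSimpleCStar (B j)) {x : A j} (hxB : x ∈ B j) (hx : ∃ k, x = star k * k)
    (hn : ‖x‖ = 1) {η : ℝ} (hη : 0 < η) :
    ∃ F ∈ conjSum (subTensor B), F 1 = 1 ∧ ∃ e : A j, ‖e - 1‖ ≤ η ∧
      ∀ c : ElemTensor A, c.1 j = x → F (tmul c) = tmul (ElemTensor.update c j e) := by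
  let _ := CStarAlgebra.spectralOrder (B j)
  have _ := CStarAlgebra.spectralOrderedRing (B j)
  -- Positivity is given by some `k` in `A j`. The square root of `x` lies in the closed subalgebra
  -- `B j` and witnesses positivity there.
  have hx0 : (0 : B j) ≤ ⟨x, hxB⟩ := by
    obtain ⟨k, rfl⟩ := hx
    refine CStarAlgebra.nonneg_iff_eq_star_mul_self.2 ⟨⟨_, cfc_sqrt_mem hcl hxB⟩, Subtype.ext ?_⟩
    change star k * k = star (cfc Real.sqrt (star k * k)) * cfc Real.sqrt (star k * k)
    rw [(isSelfAdjoint_cfc_sqrt _).star_eq, cfc_sqrt_mul_self]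
  obtain ⟨f, hf, hf1, hfx⟩ := hs.exists_conjSum_near_one hx0 hn hη
  obtain ⟨F, hF, h⟩ := exists_conjSum_subTensor j hf
  refine ⟨F, hF, ?_, f ⟨x, hxB⟩, hfx, fun c hc => ?_⟩
  · have h1 := h 1 1
    have e : ElemTensor.update (1 : ElemTensor A) j 1 = 1 := ElemTensor.update_eq_self 1 j
    rw [hf1, OneMemClass.coe_one, e, tmul_one] at h1
    exact h1
  · rw [← h c ⟨x, hxB⟩]
    subst hc
    rw [ElemTensor.update_eq_self]

/-- The coordinate maps are composed over the finite support of `h`, each changing only its own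
coordinate to some `e i` near `1`. The result is compared with `⊗ 1` by telescoping. -/
theorem exists_conjSum_tmul_near_one [Nontrivial (MinTensor A)]
    (hcl : ∀ i, IsClosed (B i : Set (A i))) (hs : ∀ i, IsSimpleCStar (B i)) {h : ElemTensor A}
    (hh : ∀ i, h.1 i ∈ B i ∧ (∃ k, h.1 i = star k * k) ∧ ‖h.1 i‖ = 1) {ε : ℝ} (hε : 0 < ε) :
    ∃ F ∈ conjSum (subTensor B), F 1 = 1 ∧ ‖F (tmul h) - 1‖ < ε := by
  classical
  obtain ⟨S, hS⟩ := ElemTensor.exists_finset h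
  -- `η ≤ 1` keeps the new coordinates within norm `2`, the constant `M` of the telescoping bound.
  set η : ℝ := min 1 (ε / (S.card * 2 ^ S.card + 1)) with hη
  have hη0 : 0 < η := by positivity
  choose F hF hF1 e he hFe using fun i =>
    exists_conjSum_coord i (hcl i) (hs i) (hh i).1 (hh i).2.1 (hh i).2.2 hη0
  have key : ∀ T : Finset I, ∃ G ∈ conjSum (subTensor B), G 1 = 1 ∧ ∃ d : ElemTensor A,
      (∀ i ∈ T, d.1 i = e i) ∧ (∀ i, i ∉ T → d.1 i = h.1 i) ∧ G (tmul h) = tmul d := fun T => by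
    induction T using Finset.induction_on with
    | empty =>
      refine ⟨conjMap 1, conjMap_mem_conjSum (one_mem _), ?_, h, by simp, by simp, ?_⟩ <;>
        simp [conjMap_apply]
    | insert j T hj ih =>
      obtain ⟨G, hG, hG1, d, hd, hd', hGd⟩ := ih
      refine ⟨F j ∘ₗ G, comp_mem_conjSum (hF j) hG, ?_, ElemTensor.update d j (e j), ?_, ?_, ?_⟩
      · rw [LinearMap.comp_apply, hG1, hF1]
      · intro i hi
        by_cases hij : i = j
        · subst hij; simp
        · rw [ElemTensor.update_of_ne _ hij, hd i (Finset.mem_of_mem_insert_of_ne hi hij)]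
      · intro i hi
        rw [Finset.mem_insert, not_or] at hi
        rw [ElemTensor.update_of_ne _ hi.1, hd' i hi.2]
      · rw [LinearMap.comp_apply, hGd, hFe j d (hd' j hj)]
  obtain ⟨G, hG, hG1, d, hd, hd', hGd⟩ := key S
  refine ⟨G, hG, hG1, ?_⟩
  have hA : ∀ i, Nontrivial (A i) := fun i => by
    by_contra hn
    rw [not_nontrivial_iff_subsingleton] at hn
    have := (hh i).2.2
    rw [Subsingleton.elim (h.1 i) 0, norm_zero] at this
    exact zero_ne_one this
  have hle : ∀ i ∈ S, ‖d.1 i - 1‖ ≤ η := fun i hi => by rw [hd i hi]; exact he i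
  rw [hGd, ← tmul_one]
  refine (norm_tmul_sub_tmul_le (δ := η) one_le_two S d 1 (fun i hi => by rw [hd' i hi, hS i hi])
    (fun i _ => rfl) (fun i hi => ?_) (fun i _ => ?_) hle).trans_lt ?_
  · have h1 := norm_add_le (d.1 i - 1) 1
    rw [sub_add_cancel, CStarRing.norm_one] at h1
    linarith [hle i hi, min_le_left (1 : ℝ) (ε / (S.card * 2 ^ S.card + 1))]
  · rw [ElemTensor.one_apply, CStarRing.norm_one]; exact one_le_two
  · refine (mul_le_mul_of_nonneg_left (min_le_right _ _) (by positivity)).trans_lt ?_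
    rw [mul_div_assoc', div_lt_iff₀ (by positivity)]
    linarith

/-- Excision compresses `x* x` to almost `r h` with `r = ψ (x* x) > 0`. A unital sum of conjugations
moves `h` to almost `1` without enlarging the error, and division by `r` then puts `1` in the
closure of `J`. -/
theorem isCStarIrreducible_subTensor_of_excision {ψ : ∀ i, CStarState (A i)}
    (hcl : ∀ i, IsClosed (B i : Set (A i))) (hψ : ∀ i, (ψ i).IsFaithful)
    (hB : ∀ i, HasRelativeExcision (B i) (ψ i)) (hs : ∀ i, IsSimpleCStar (B i)) :
    IsCStarIrreducible (subTensor B) := by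
  classical
  have := (productState ψ).nontrivial
  refine isCStarIrreducible_of_invariant _ fun x hx J hxJ hJ => ?_
  obtain ⟨h, hh, hlim⟩ := exists_excision_net hB
  set p := star x * x with hp
  set r : ℝ := (productState ψ p).re with hr
  have hrp : productState ψ p = (r : ℂ) := CStarState.map_star_mul_self _ x
  have hr0 : 0 < r := by
    refine lt_of_le_of_ne (CStarState.re_sq_nonneg _ x) fun h0 => hx ?_
    refine productState_isFaithful ψ hψ x ?_
    rw [← hp, hrp, ← h0, Complex.ofReal_zero]
  refine Metric.mem_closure_iff.2 fun ε hε => ?_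
  -- The factor `r` in the tolerance compensates for the later division by `r`.
  obtain ⟨l, hl⟩ := ((hlim p).eventually (gt_mem_nhds (show 0 < r * (ε / 2) by positivity))).exists
  obtain ⟨F, hF, hF1, hFl⟩ := exists_conjSum_tmul_near_one hcl hs (hh l) (half_pos hε)
  set t := cfc Real.sqrt (tmul (h l)) with ht
  have hts : star t = t := (isSelfAdjoint_cfc_sqrt _).star_eq
  have htB : t ∈ subTensor B := by
    rw [ht, cfc_sqrt_tmul fun i => (hh l i).2.1]
    exact tmul_mem_subTensor fun i => cfc_sqrt_mem (hcl i) (hh l i).1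
  -- The contraction estimate for sums of conjugations is available on self-adjoint elements only.
  have hz : IsSelfAdjoint (t * p * t - productState ψ p • tmul (h l)) := by
    obtain ⟨k, hk⟩ := exists_tmul_eq_star_mul fun i => (hh l i).2.1
    rw [IsSelfAdjoint, star_sub, star_smul, hrp, hk, hp]
    simp [hts, mul_assoc]
  have h1 := norm_conjSum_apply_le hF hF1 hz
  rw [map_sub, map_smul, hrp] at h1
  have hm : t * p * t ∈ J := by
    have := hJ t htB p hxJ
    rwa [hts] at this
  have hm' : F (t * p * t) ∈ J :=
    conjSum_apply_mem hF (J := J.toAddSubmonoid) (fun b hb y hy => hJ b hb y hy) hm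
  refine ⟨(r : ℂ)⁻¹ • F (t * p * t), J.smul_mem _ hm', ?_⟩
  have hrc : (r : ℂ) ≠ 0 := by exact_mod_cast hr0.ne'
  have e : (r : ℂ)⁻¹ • F (t * p * t) - 1 =
      (r : ℂ)⁻¹ • (F (t * p * t) - (r : ℂ) • F (tmul (h l))) + (F (tmul (h l)) - 1) := by
    rw [smul_sub, smul_smul, inv_mul_cancel₀ hrc, one_smul]; abel
  rw [dist_comm, dist_eq_norm, e]
  refine (norm_add_le _ _).trans_lt ?_
  have h2 : ‖(r : ℂ)⁻¹ • (F (t * p * t) - (r : ℂ) • F (tmul (h l)))‖ ≤ ε / 2 := by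
    rw [norm_smul, norm_inv, Complex.norm_real, Real.norm_of_nonneg hr0.le,
      inv_mul_le_iff₀ hr0]
    rw [hrp] at hl
    exact h1.trans hl.le
  linarith

end ExcisionIrreducible

end

theorem mainTheorem9 {I : Type*} {A : I → Type*} [∀ i, CStarAlgebra (A i)]
    (B : ∀ i, StarSubalgebra ℂ (A i)) (hB : ∀ i, IsClosed (B i : Set (A i))) :
    (∀ τ : ∀ i, CStarState (A i),
      (∀ i, (τ i).IsTracial ∧ (τ i).IsFaithful ∧ HasRelativeDixmier (B i)) →
        (productState τ).IsTracial ∧ (productState τ).IsFaithful ∧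
        HasRelativeDixmier (subTensor B) ∧
        (∀ a : MinTensor A, dixmierSet (subTensor B) a ∩ Set.range (algebraMap ℂ (MinTensor A)) =
          {algebraMap ℂ (MinTensor A) (productState τ a)}) ∧
        IsCStarIrreducible (subTensor B)) ∧
    (∀ ψ : ∀ i, CStarState (A i),
      (∀ i, (ψ i).IsFaithful ∧ HasRelativeExcision (B i) (ψ i)) →
        (productState ψ).IsFaithful ∧
        HasRelativeExcision (subTensor B) (productState ψ) ∧
        ((∀ i, IsSimpleCStar (B i)) → IsCStarIrreducible (subTensor B))) := by
  refine ⟨fun τ h => ?_, fun ψ h => ?_⟩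
  · have hf := productState_isFaithful τ fun i => (h i).2.1
    exact ⟨productState_isTracial τ fun i => (h i).1, hf,
      hasRelativeDixmier_subTensor (fun i => (h i).1) fun i => (h i).2.2,
      dixmierSet_subTensor_inter (fun i => (h i).1) fun i => (h i).2.2,
      isCStarIrreducible_of_mem_dixmierSet _ _ hf
        (productState_smul_one_mem_dixmierSet (fun i => (h i).1) fun i => (h i).2.2)⟩
  · exact ⟨productState_isFaithful ψ fun i => (h i).1,
      hasRelativeExcision_subTensor fun i => (h i).2,
      isCStarIrreducible_subTensor_of_excision hB (fun i => (h i).1) fun i => (h i).2⟩
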